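/- All graphs are finite and simple. A tree model of a graph $G=(V_G,E_G)$ is a pair $(T,\{T_v\}_{v\in V_G})$, where $T$ is a tree (the host tree), each $T_v$ is a (nonempty) subtree of $T$, and distinct vertices $u,v$ are adjacent in $G$ if and only if $V(T_u)\cap V(T_v)\neq\emptyset$. A graph is chordal if it has a tree model, and its leafage $\ell(G)$ is the least number of leaves (nodes of degree one) of the host tree in a tree model of $G$. A leaf of a rooted tree is a node other than the root that has no children; if $T$ is rooted, each $T_v$ is rooted at its node closest to the root of $T$. A tree model is expanded if $T$ is rooted, every $T_v$ has at least one leaf as a rooted tree, and every node of $T$ is the root or a leaf of $T_v$ for at most one vertex $v$. In the Subset Feedback Vertex Set problem one is given a graph $G$ with integer vertex weights and a set $S\subseteq V_G$, and asks for a set $X\subseteq V_G$ of minimum total weight that meets every cycle of $G$ that contains a vertex of $S$. Theorem. There is an algorithm that, given a connected chordal graph $G$ on $n$ vertices with leafage $\ell=\ell(G)\ge 2$, a set $S\subseteq V_G$, integer vertex weights, and an expanded tree model of $G$ whose rooted host tree has at most $\ell$ leaves and $O(n)$ nodes, outputs a minimum-weight solution of Subset Feedback Vertex Set in $O(n^{2\ell+1})$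 time. Precisely: there is one program for the uniform-cost random access machine (integer registers and arrays, with addition, subtraction, comparison with zero and indirect addressing) such that for all integers $\ell\ge 2$ and $K\ge 0$ there is a constant $C$ for which, on every such input with leafage $\ell$ and at most $Kn$ host nodes, the program halts after at most $Cn^{2\ell+1}$ steps with an optimal solution as its output. (The graph is given by its adjacency matrix, the host tree by its parent pointers, and the subtrees by their membership matrix.) -/

import Mathlib

/-! ### Rooted host trees and tree models -/

/-- A rooted tree on the nodes `0, …, N - 1`, whose edges are directed towards the root: every node
other than the root points to its parent, and following the parents one arrives at the root. (By
convention the root is its own parent.) -/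
structure HostTree (N : ℕ) where
  root : Fin N
  parent : Fin N → Fin N
  parent_root : parent root = root
  reaches_root : ∀ x, ∃ k : ℕ, parent^[k] x = root

namespace HostTree

variable {N : ℕ} (T : HostTree N)

/-- The underlying undirected tree: its edges join the nodes `x` other than the root with
`parent x`. -/
def graph : SimpleGraph (Fin N) := SimpleGraph.fromRel fun x y => T.parent x = y

/-- `x` is a descendant of `y`, that is, there is a directed path (possibly of length `0`) from `x`
to `y`. -/
def Desc (x y : Fin N) : Prop := ∃ k : ℕ, T.parent^[k] x = y

/-- `s` is the node set of a subtree of the tree, that is, it is nonempty and connected. -/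
def IsSubtree (s : Set (Fin N)) : Prop := (T.graph.induce s).Connected

/-- `t` is the root of the subtree `s`. -/
def IsRootOf (s : Set (Fin N)) (t : Fin N) : Prop := t ∈ s ∧ ∀ x ∈ s, T.Desc x t

/-- `x` is a leaf of the rooted subtree `s`: a node of `s`, not the root of `s`, that has no child
in `s`. In particular a one-node subtree has no leaf. -/
def IsLeafOf (s : Set (Fin N)) (x : Fin N) : Prop :=
  x ∈ s ∧ ¬ T.IsRootOf s x ∧ ∀ y ∈ s, T.parent y ≠ x

/-- The number of leaves of the rooted tree. The root is never a leaf. -/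
noncomputable def numRootedLeaves : ℕ := {x | T.IsLeafOf Set.univ x}.ncard

/-- The number of leaves of the underlying undirected tree: the nodes of degree one. (A one-node
tree has no leaf.) -/
noncomputable def numLeaves : ℕ := {x | (T.graph.neighborSet x).ncard = 1}.ncard

end HostTree

/-- A tree model of a graph `G`, with a host tree on `N` nodes: every vertex `v` of `G` is assigned
a subtree of the host tree, and two distinct vertices are adjacent if and only if their subtrees
share a node. The graphs that have a tree model are the chordal graphs. -/
structure TreeModel {n : ℕ} (G : SimpleGraph (Fin n)) (N : ℕ) where
  host : HostTree N
  sub : Fin n → Set (Fin N)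
  isSubtree : ∀ v, host.IsSubtree (sub v)
  adj_iff : ∀ u v, u ≠ v → (G.Adj u v ↔ (sub u ∩ sub v).Nonempty)

/-- A tree model is expanded if every subtree `T_v` has a leaf (as a rooted tree), and every node of
the host tree is the root or a leaf of at most one of the subtrees `T_v`. -/
def TreeModel.IsExpanded {n : ℕ} {G : SimpleGraph (Fin n)} {N : ℕ} (M : TreeModel G N) : Prop :=
  (∀ v, ∃ x, M.host.IsLeafOf (M.sub v) x) ∧
  ∀ x u v,
    (M.host.IsRootOf (M.sub u) x ∨ M.host.IsLeafOf (M.sub u) x) →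
    (M.host.IsRootOf (M.sub v) x ∨ M.host.IsLeafOf (M.sub v) x) → u = v

/-- The leafage of a chordal graph: the least number of leaves of the (undirected) host tree in a
tree model of the graph. -/
noncomputable def leafage {n : ℕ} (G : SimpleGraph (Fin n)) : ℕ :=
  sInf {k | ∃ (N : ℕ) (M : TreeModel G N), M.host.numLeaves = k}

/-! ### Subset Feedback Vertex Set -/

/-- `X` is a subset feedback vertex set of `(G, S)`: it meets every cycle of `G` that contains a
vertex of `S`. -/
def IsSubsetFVS {n : ℕ} (G : SimpleGraph (Fin n)) (S X : Finset (Fin n)) : Prop :=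
  ∀ (v : Fin n) (c : G.Walk v v), c.IsCycle → (∃ s ∈ S, s ∈ c.support) → ∃ x ∈ X, x ∈ c.support

/-- `X` is a subset feedback vertex set of `(G, S)` of minimum weight. -/
def IsMinSubsetFVS {n : ℕ} (G : SimpleGraph (Fin n)) (S : Finset (Fin n)) (w : Fin n → ℤ)
    (X : Finset (Fin n)) : Prop :=
  IsSubsetFVS G S X ∧ ∀ Y, IsSubsetFVS G S Y → ∑ v ∈ X, w v ≤ ∑ v ∈ Y, w v

/-! ### Random access machines

The uniform-cost random access machine over the integers, with addition and subtraction as its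
arithmetic, programmed in a structured language. A program is a finite object, so that it mentions
only finitely many registers and arrays, and all of them by constant names; only the positions
within an array are addressed indirectly. -/

/-- A state of the machine: the contents of the registers, and of the cells of the arrays. -/
structure RAMState where
  reg : ℕ → ℤ
  arr : ℕ → ℕ → ℤ

/-- Programs. -/
inductive RAMProg where
  /-- do nothing -/
  | skip : RAMProg
  /-- `reg d := c` -/
  | const (d : ℕ) (c : ℤ) : RAMProg
  /-- `reg d := reg a + reg b` -/
  | add (d a b : ℕ) : RAMProg
  /-- `reg d := reg a - reg b` -/
  | sub (d a b : ℕ) : RAMProg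
  /-- `reg d := arr a [reg i]` -/
  | load (d a i : ℕ) : RAMProg
  /-- `arr a [reg i] := reg s` -/
  | store (a i s : ℕ) : RAMProg
  /-- first `p`, then `q` -/
  | seq (p q : RAMProg) : RAMProg
  /-- if `reg a > 0` then `p` else `q` -/
  | cond (a : ℕ) (p q : RAMProg) : RAMProg
  /-- while `reg a > 0` do `p` -/
  | loop (a : ℕ) (p : RAMProg) : RAMProg

namespace RAMState

/-- Write the value `z` into register `d`. -/
def setReg (σ : RAMState) (d : ℕ) (z : ℤ) : RAMState :=
  { σ with reg := Function.update σ.reg d z }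

/-- Write the value `z` into cell `i` of array `a`. -/
def setArr (σ : RAMState) (a i : ℕ) (z : ℤ) : RAMState :=
  { σ with arr := Function.update σ.arr a (Function.update (σ.arr a) i z) }

end RAMState

/-- `Exec p σ τ t`: started in the state `σ`, the program `p` halts in the state `τ` after exactly
`t` steps. Each elementary instruction and each evaluation of a test takes one step. A negative
position in an array is read as position `0`. -/
inductive Exec : RAMProg → RAMState → RAMState → ℕ → Prop
  | skip (σ : RAMState) : Exec RAMProg.skip σ σ 1
  | const (σ : RAMState) (d : ℕ) (c : ℤ) : Exec (RAMProg.const d c) σ (σ.setReg d c) 1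
  | add (σ : RAMState) (d a b : ℕ) :
      Exec (RAMProg.add d a b) σ (σ.setReg d (σ.reg a + σ.reg b)) 1
  | sub (σ : RAMState) (d a b : ℕ) :
      Exec (RAMProg.sub d a b) σ (σ.setReg d (σ.reg a - σ.reg b)) 1
  | load (σ : RAMState) (d a i : ℕ) :
      Exec (RAMProg.load d a i) σ (σ.setReg d (σ.arr a (σ.reg i).toNat)) 1
  | store (σ : RAMState) (a i s : ℕ) :
      Exec (RAMProg.store a i s) σ (σ.setArr a (σ.reg i).toNat (σ.reg s)) 1
  | seq (p q : RAMProg) (σ ρ τ : RAMState) (t₁ t₂ : ℕ) :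
      Exec p σ ρ t₁ → Exec q ρ τ t₂ → Exec (RAMProg.seq p q) σ τ (t₁ + t₂)
  | cond_pos (a : ℕ) (p q : RAMProg) (σ τ : RAMState) (t : ℕ) :
      0 < σ.reg a → Exec p σ τ t → Exec (RAMProg.cond a p q) σ τ (t + 1)
  | cond_neg (a : ℕ) (p q : RAMProg) (σ τ : RAMState) (t : ℕ) :
      ¬ 0 < σ.reg a → Exec q σ τ t → Exec (RAMProg.cond a p q) σ τ (t + 1)
  | loop_done (a : ℕ) (p : RAMProg) (σ : RAMState) :
      ¬ 0 < σ.reg a → Exec (RAMProg.loop a p) σ σ 1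
  | loop_step (a : ℕ) (p : RAMProg) (σ ρ τ : RAMState) (t₁ t₂ : ℕ) :
      0 < σ.reg a → Exec p σ ρ t₁ → Exec (RAMProg.loop a p) ρ τ t₂ →
      Exec (RAMProg.loop a p) σ τ (t₁ + t₂ + 1)

/-! ### Input and output conventions -/

open Classical in
/-- The contents of the arrays at the start, for the graph `G` with terminal set `S`, vertex weights
`w` and tree model `M`; cells that are not mentioned hold `0`.
* Array `0` holds `n`, the number `N` of host nodes, and the root of the host tree.
* Array `1` is the adjacency matrix of `G`: cell `n * u + v` holds `1` if `u` and `v` are adjacent.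
* Array `2` is the indicator of `S`: cell `v` holds `1` if `v ∈ S`.
* Array `3` holds the weights: cell `v` holds `w v`.
* Array `4` is the host tree: cell `x` holds the parent of `x` (the root is its own parent).
* Array `5` holds the subtrees: cell `N * v + x` holds `1` if `x` is a node of the subtree of `v`. -/
noncomputable def inputArr {n N : ℕ} (G : SimpleGraph (Fin n)) (S : Finset (Fin n))
    (w : Fin n → ℤ) (M : TreeModel G N) : ℕ → ℕ → ℤ
  | 0, 0 => n
  | 0, 1 => N
  | 0, 2 => (M.host.root : ℕ)
  | 1, i => if ∃ u v : Fin n, G.Adj u v ∧ i = n * u + v then 1 else 0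
  | 2, i => if ∃ v ∈ S, i = (v : ℕ) then 1 else 0
  | 3, i => if h : i < n then w ⟨i, h⟩ else 0
  | 4, i => if h : i < N then ((M.host.parent ⟨i, h⟩ : ℕ) : ℤ) else 0
  | 5, i => if ∃ (v : Fin n) (x : Fin N), x ∈ M.sub v ∧ i = N * v + x then 1 else 0
  | _, _ => 0

/-- The initial state: the input is in the arrays and all registers are `0`. -/
noncomputable def inputState {n N : ℕ} (G : SimpleGraph (Fin n)) (S : Finset (Fin n))
    (w : Fin n → ℤ) (M : TreeModel G N) : RAMState :=
  { reg := fun _ => 0, arr := inputArr G S w M }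

/-- The final state `τ` outputs the vertex set `X`: the first `n` cells of array `6` are the
indicator of `X`. -/
def Outputs {n : ℕ} (τ : RAMState) (X : Finset (Fin n)) : Prop :=
  ∀ v : Fin n, τ.arr 6 v = if v ∈ X then 1 else 0

/-! In a chordal graph a set meets every cycle through a terminal as soon as it meets every triangle
containing a terminal (`isSubsetFVS_iff`). Indeed, the two neighbours of a terminal `s` on a cycle
stay connected without `s`, and discarding simplicial vertices shrinks the connection until two
adjacent neighbours of `s` appear. So one seeks a set `Y` of greatest weight without terminal
triangles; its complement is an optimal solution.

Let `Y` grow in the order of increasing levels, the level being the depth of the root of the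
subtree. When `v` is added and `t` is the root of its subtree, the neighbours of `v` in `Y` are the
vertices whose subtrees contain `t`, and they form a clique. Fix a tip `p` below `t`. An earlier
subtree meets the path from `p` to the host root in a (possibly empty) interval of depths that does
not start below `t`, so it contains `t` exactly when it reaches at least as deep as `t`
(`IsSubtree.mem_iff_lt_reach`). It suffices to remember the two furthest reaches towards `p` and
whether they belong to terminals: three vertices of `Y` containing `t` form a triangle in `Y`, so
none of them is a terminal; and if only two contain `t`, they are the two remembered ones. Hence the
pairs of largest labels, one pair per tip, decide whether `v` may be added (`exists_blocked_iff`),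
and the recursion over these states is exact (`chosenSet_optimal`).

Labels are below `B = 2 * N + 2`, so `r ≤ ℓ` tips give `W = B ^ (2 * r)` codes of states. The `n`
layers of `W` values fit the time bound if a transition costs constant time for fixed `ℓ`. To
achieve this, all transitions of a vertex are tabulated together: a code has one digit in base `B *
B` for each tip, the digits change independently, and the table for one more tip arises by adding
the new digit to the old entries (`wp_computeNext`). A blocked digit contributes `W`, so a single
comparison detects forbidden transitions. All other work is of lower order because `ℓ ≥ 2`
(`time_le`). -/

/-! ### A program logic for the random access machine -/

namespace RAMProg

/-- The registers that a program may write. -/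
def regs : RAMProg → List ℕ
  | skip => []
  | const d _ => [d]
  | add d _ _ => [d]
  | sub d _ _ => [d]
  | load d _ _ => [d]
  | store _ _ _ => []
  | seq p q => p.regs ++ q.regs
  | cond _ p q => p.regs ++ q.regs
  | loop _ p => p.regs

/-- The arrays that a program may write. -/
def arrs : RAMProg → List ℕ
  | skip => []
  | const _ _ => []
  | add _ _ _ => []
  | sub _ _ _ => []
  | load _ _ _ => []
  | store a _ _ => [a]
  | seq p q => p.arrs ++ q.arrs
  | cond _ p q => p.arrs ++ q.arrs
  | loop _ p => p.arrs

/-- Sequential composition of a list of programs. -/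
def block : List RAMProg → RAMProg
  | [] => skip
  | [p] => p
  | p :: q :: l => seq p (block (q :: l))

/-- Decrement register `c` and run `body`, until `c` is `0`; register `0` has to hold `1`. So the
body runs with the values `k - 1, …, 0` in register `c`, where `k` is the value at the start. -/
def forDown (c : ℕ) (body : RAMProg) : RAMProg := loop c (seq (sub c c 0) body)

end RAMProg

namespace RAMState

@[simp] theorem setReg_reg (σ : RAMState) (d : ℕ) (z : ℤ) (a : ℕ) :
    (σ.setReg d z).reg a = if a = d then z else σ.reg a := by
  simp [setReg, Function.update_apply]

@[simp] theorem setReg_arr (σ : RAMState) (d : ℕ) (z : ℤ) : (σ.setReg d z).arr = σ.arr := rfl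

@[simp] theorem setArr_reg (σ : RAMState) (a i : ℕ) (z : ℤ) : (σ.setArr a i z).reg = σ.reg := rfl

@[simp] theorem setArr_arr (σ : RAMState) (a i : ℕ) (z : ℤ) (b j : ℕ) :
    (σ.setArr a i z).arr b j = if b = a then (if j = i then z else σ.arr b j) else σ.arr b j := by
  by_cases h : b = a
  · subst h
    simp [setArr, Function.update_apply]
  · simp [setArr, h]

end RAMState

/-! ### Frame conditions -/

/-- `τ` agrees with `σ` on all registers and arrays that `p` does not write. -/
def Frame (p : RAMProg) (σ τ : RAMState) : Prop :=
  (∀ r ∉ p.regs, τ.reg r = σ.reg r) ∧ (∀ a ∉ p.arrs, τ.arr a = σ.arr a)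

theorem Frame.refl (p : RAMProg) (σ : RAMState) : Frame p σ σ := ⟨fun _ _ => rfl, fun _ _ => rfl⟩

theorem Frame.trans {p : RAMProg} {σ ρ τ : RAMState} (h₁ : Frame p σ ρ) (h₂ : Frame p ρ τ) :
    Frame p σ τ :=
  ⟨fun r hr => (h₂.1 r hr).trans (h₁.1 r hr), fun a ha => (h₂.2 a ha).trans (h₁.2 a ha)⟩

theorem Frame.mono {p q : RAMProg} {σ τ : RAMState} (h : Frame p σ τ)
    (hr : ∀ r, r ∈ p.regs → r ∈ q.regs) (ha : ∀ a, a ∈ p.arrs → a ∈ q.arrs) : Frame q σ τ :=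
  ⟨fun r h' => h.1 r fun h'' => h' (hr r h''), fun a h' => h.2 a fun h'' => h' (ha a h'')⟩

/-- The syntactic write lists contain every register and array that an execution can change. Later
proofs carry values across a subprogram by deciding non-membership in these finite lists. -/
theorem Frame.of_exec {p : RAMProg} {σ τ : RAMState} {t : ℕ} (h : Exec p σ τ t) :
    Frame p σ τ := by
  induction h with
  | skip => exact Frame.refl _ _
  | const σ d c =>
    refine ⟨fun r hr => ?_, fun a _ => rfl⟩
    simp only [RAMProg.regs, List.mem_singleton] at hr
    simp [hr]
  | add σ d a b =>
    refine ⟨fun r hr => ?_, fun a _ => rfl⟩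
    simp only [RAMProg.regs, List.mem_singleton] at hr
    simp [hr]
  | sub σ d a b =>
    refine ⟨fun r hr => ?_, fun a _ => rfl⟩
    simp only [RAMProg.regs, List.mem_singleton] at hr
    simp [hr]
  | load σ d a i =>
    refine ⟨fun r hr => ?_, fun a _ => rfl⟩
    simp only [RAMProg.regs, List.mem_singleton] at hr
    simp [hr]
  | store σ a i s =>
    refine ⟨fun r _ => rfl, fun b hb => ?_⟩
    simp only [RAMProg.arrs, List.mem_singleton] at hb
    funext j
    simp [hb]
  | seq p q σ ρ τ t₁ t₂ _ _ ih₁ ih₂ =>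
    exact (ih₁.mono (by simp +contextual [RAMProg.regs]) (by simp +contextual [RAMProg.arrs])).trans
      (ih₂.mono (by simp +contextual [RAMProg.regs]) (by simp +contextual [RAMProg.arrs]))
  | cond_pos a p q σ τ t _ _ ih =>
    exact ih.mono (by simp +contextual [RAMProg.regs]) (by simp +contextual [RAMProg.arrs])
  | cond_neg a p q σ τ t _ _ ih =>
    exact ih.mono (by simp +contextual [RAMProg.regs]) (by simp +contextual [RAMProg.arrs])
  | loop_done => exact Frame.refl _ _
  | loop_step a p σ ρ τ t₁ t₂ _ _ _ ih₁ ih₂ =>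
    exact Frame.trans (ih₁.mono (fun _ h => h) (fun _ h => h)) ih₂

/-! ### Total correctness assertions with step counts -/

/-- Started in `σ`, the program `p` halts in a state `τ` after `t` steps with `Q τ t`. -/
def wp (p : RAMProg) (σ : RAMState) (Q : RAMState → ℕ → Prop) : Prop :=
  ∃ τ t, Exec p σ τ t ∧ Q τ t

/-- The consequence rule also supplies the frame condition, so a specification only has to mention
what its program computes. -/
theorem wp_mono {p : RAMProg} {σ : RAMState} {Q R : RAMState → ℕ → Prop} (h : wp p σ Q)
    (hQR : ∀ τ t, Frame p σ τ → Q τ t → R τ t) : wp p σ R := by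
  obtain ⟨τ, t, he, hq⟩ := h
  exact ⟨τ, t, he, hQR τ t (Frame.of_exec he) hq⟩

@[simp] theorem wp_skip {σ : RAMState} {Q : RAMState → ℕ → Prop} : wp .skip σ Q ↔ Q σ 1 :=
  ⟨by rintro ⟨_, _, ⟨⟩, h⟩; exact h, fun h => ⟨_, _, .skip σ, h⟩⟩

@[simp] theorem wp_const {σ : RAMState} {Q : RAMState → ℕ → Prop} {d : ℕ} {c : ℤ} :
    wp (.const d c) σ Q ↔ Q (σ.setReg d c) 1 :=
  ⟨by rintro ⟨_, _, ⟨⟩, h⟩; exact h, fun h => ⟨_, _, .const σ d c, h⟩⟩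

@[simp] theorem wp_add {σ : RAMState} {Q : RAMState → ℕ → Prop} {d a b : ℕ} :
    wp (.add d a b) σ Q ↔ Q (σ.setReg d (σ.reg a + σ.reg b)) 1 :=
  ⟨by rintro ⟨_, _, ⟨⟩, h⟩; exact h, fun h => ⟨_, _, .add σ d a b, h⟩⟩

@[simp] theorem wp_sub {σ : RAMState} {Q : RAMState → ℕ → Prop} {d a b : ℕ} :
    wp (.sub d a b) σ Q ↔ Q (σ.setReg d (σ.reg a - σ.reg b)) 1 :=
  ⟨by rintro ⟨_, _, ⟨⟩, h⟩; exact h, fun h => ⟨_, _, .sub σ d a b, h⟩⟩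

@[simp] theorem wp_load {σ : RAMState} {Q : RAMState → ℕ → Prop} {d a i : ℕ} :
    wp (.load d a i) σ Q ↔ Q (σ.setReg d (σ.arr a (σ.reg i).toNat)) 1 :=
  ⟨by rintro ⟨_, _, ⟨⟩, h⟩; exact h, fun h => ⟨_, _, .load σ d a i, h⟩⟩

@[simp] theorem wp_store {σ : RAMState} {Q : RAMState → ℕ → Prop} {a i s : ℕ} :
    wp (.store a i s) σ Q ↔ Q (σ.setArr a (σ.reg i).toNat (σ.reg s)) 1 :=
  ⟨by rintro ⟨_, _, ⟨⟩, h⟩; exact h, fun h => ⟨_, _, .store σ a i s, h⟩⟩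

theorem wp_seq {p q : RAMProg} {σ : RAMState} {Q : RAMState → ℕ → Prop} :
    wp (.seq p q) σ Q ↔ wp p σ fun ρ t₁ => wp q ρ fun τ t₂ => Q τ (t₁ + t₂) := by
  constructor
  · rintro ⟨τ, t, h, hQ⟩
    cases h with
    | seq _ _ _ ρ _ t₁ t₂ h₁ h₂ => exact ⟨ρ, t₁, h₁, τ, t₂, h₂, hQ⟩
  · rintro ⟨ρ, t₁, h₁, τ, t₂, h₂, hQ⟩
    exact ⟨τ, _, .seq _ _ _ _ _ _ _ h₁ h₂, hQ⟩

@[simp] theorem wp_cond {p q : RAMProg} {σ : RAMState} {Q : RAMState → ℕ → Prop} {a : ℕ} :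
    wp (.cond a p q) σ Q ↔
      (0 < σ.reg a → wp p σ fun τ t => Q τ (t + 1)) ∧
      (¬ 0 < σ.reg a → wp q σ fun τ t => Q τ (t + 1)) := by
  constructor
  · rintro ⟨τ, t, h, hQ⟩
    cases h with
    | cond_pos _ _ _ _ _ t h₁ h₂ => exact ⟨fun _ => ⟨τ, t, h₂, hQ⟩, fun h => absurd h₁ h⟩
    | cond_neg _ _ _ _ _ t h₁ h₂ => exact ⟨fun h => absurd h h₁, fun _ => ⟨τ, t, h₂, hQ⟩⟩
  · rintro ⟨h₁, h₂⟩
    by_cases h : 0 < σ.reg a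
    · obtain ⟨τ, t, h', hQ⟩ := h₁ h
      exact ⟨τ, _, .cond_pos _ _ _ _ _ _ h h', hQ⟩
    · obtain ⟨τ, t, h', hQ⟩ := h₂ h
      exact ⟨τ, _, .cond_neg _ _ _ _ _ _ h h', hQ⟩

@[simp] theorem wp_block_singleton {p : RAMProg} {σ : RAMState} {Q : RAMState → ℕ → Prop} :
    wp (.block [p]) σ Q ↔ wp p σ Q := Iff.rfl

@[simp] theorem wp_block_cons {p q : RAMProg} {l : List RAMProg} {σ : RAMState}
    {Q : RAMState → ℕ → Prop} :
    wp (.block (p :: q :: l)) σ Q ↔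
      wp p σ fun ρ t₁ => wp (.block (q :: l)) ρ fun τ t₂ => Q τ (t₁ + t₂) := wp_seq

/-- The rule for a downward loop with invariant `I`: here `I i ρ s` holds when the values below `i`
are still to be processed, and `s` steps have been made. -/
theorem wp_forDown_elapsed {c : ℕ} {body : RAMProg} {σ : RAMState} {Q : RAMState → ℕ → Prop}
    (k : ℕ) (I : ℕ → RAMState → ℕ → Prop) (hk : σ.reg c = k) (hone : σ.reg 0 = 1)
    (hc : c ∉ body.regs) (hzero : 0 ∉ c :: body.regs) (hI : I k σ 0)
    (step : ∀ i < k, ∀ ρ s, Frame (.forDown c body) σ ρ → I (i + 1) ρ s →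
      wp body (ρ.setReg c i) fun τ t => I i τ (s + t + 2))
    (post : ∀ τ t, Frame (.forDown c body) σ τ → I 0 τ t → Q τ (t + 1)) :
    wp (.forDown c body) σ Q := by
  suffices H : ∀ j ≤ k, ∀ ρ s, Frame (.forDown c body) σ ρ → ρ.reg c = j → I j ρ s →
      wp (.forDown c body) ρ fun τ t => Q τ (s + t) by
    simpa using H k le_rfl σ 0 (Frame.refl _ _) hk hI
  intro j
  induction j with
  | zero =>
    intro _ ρ s hF hr hI
    exact ⟨ρ, 1, .loop_done _ _ _ (by simp [hr]), post ρ s hF hI⟩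
  | succ i ih =>
    intro hi ρ s hF hr hI
    obtain ⟨τ, t, he, hIτ⟩ := step i hi ρ s hF hI
    have hone' : ρ.reg 0 = 1 := by
      rw [hF.1 0 (by simpa [RAMProg.forDown, RAMProg.regs] using hzero), hone]
    have he' : Exec (.seq (.sub c c 0) body) ρ τ (1 + t) := by
      refine .seq _ _ _ (ρ.setReg c i) _ _ _ ?_ he
      have := Exec.sub ρ c c 0
      rwa [hr, hone', Nat.cast_succ, add_sub_cancel_right] at this
    have hτc : τ.reg c = i := by
      rw [(Frame.of_exec he).1 c hc]
      simp
    have hFτ : Frame (.forDown c body) σ τ := hF.trans ((Frame.of_exec he').mono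
      (fun _ h => h) (fun _ h => h))
    obtain ⟨τ', t', he₂, hQ⟩ := ih (by omega) τ _ hFτ hτc hIτ
    refine ⟨τ', _, .loop_step _ _ _ _ _ _ _ (by rw [hr]; positivity) he' he₂, ?_⟩
    -- An iteration costs two steps besides the body: the test and the decrement. The extra step in
    -- `post` is the final failing test.
    change Q τ' (s + (1 + t + t' + 1))
    rwa [show s + (1 + t + t' + 1) = s + t + 2 + t' by omega]

/-- The rule for a downward loop whose body takes at most `T` steps. -/
theorem wp_forDown {c : ℕ} {body : RAMProg} {σ : RAMState} {Q : RAMState → ℕ → Prop}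
    (k T : ℕ) (I : ℕ → RAMState → Prop) (hk : σ.reg c = k) (hone : σ.reg 0 = 1)
    (hc : c ∉ body.regs) (hzero : 0 ∉ c :: body.regs) (hI : I k σ)
    (step : ∀ i < k, ∀ ρ, Frame (.forDown c body) σ ρ → I (i + 1) ρ →
      wp body (ρ.setReg c i) fun τ t => t ≤ T ∧ I i τ)
    (post : ∀ τ t, Frame (.forDown c body) σ τ → I 0 τ → t ≤ k * (T + 2) + 1 → Q τ t) :
    wp (.forDown c body) σ Q := by
  refine wp_forDown_elapsed k (fun i ρ s => i ≤ k ∧ I i ρ ∧ s ≤ (k - i) * (T + 2)) hk hone hc hzero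
    ⟨le_rfl, hI, by simp⟩ ?_ ?_
  · rintro i hi ρ s hF ⟨-, hI, hs⟩
    refine wp_mono (step i hi ρ hF hI) fun τ t _ ⟨ht, hτ⟩ => ⟨hi.le, hτ, ?_⟩
    rw [show k - i = k - (i + 1) + 1 by omega, Nat.succ_mul]
    omega
  · rintro τ t hF ⟨-, hI, ht⟩
    exact post τ _ hF hI (by simpa using ht)

/-- Add register `a` to register `d` as often as register `c` says, and leave `0` in `c`. -/
def RAMProg.addLoop (d a c : ℕ) : RAMProg := .forDown c (.add d d a)

theorem wp_addLoop {d a c : ℕ} {σ : RAMState} {Q : RAMState → ℕ → Prop} (k : ℕ)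
    (hk : σ.reg c = k) (hone : σ.reg 0 = 1) (hne : c ≠ d ∧ c ≠ 0 ∧ d ≠ 0 ∧ a ≠ c ∧ a ≠ d)
    (post : ∀ τ t, Frame (.addLoop d a c) σ τ → τ.reg d = σ.reg d + k * σ.reg a →
      t ≤ 3 * k + 1 → Q τ t) :
    wp (.addLoop d a c) σ Q := by
  obtain ⟨h₁, h₂, h₃, h₄, h₅⟩ := hne
  refine wp_forDown k 1 (fun i ρ => ρ.reg d = σ.reg d + ((k : ℤ) - i) * σ.reg a) hk hone
    (by simpa [RAMProg.regs] using h₁) (by simp [RAMProg.regs, h₂.symm, h₃.symm]) (by simp) ?_ ?_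
  · intro i _ ρ hF hI
    have ha : ρ.reg a = σ.reg a := hF.1 a (by simp [RAMProg.forDown, RAMProg.regs, h₄, h₅])
    simp only [wp_add, le_refl, true_and]
    simp only [RAMState.setReg_reg, if_true, h₁.symm, h₄, if_false, hI, ha]
    push_cast
    ring
  · intro τ t hF hI ht
    exact post τ t hF (by simpa using hI) (by omega)

/-! ### Depths and subtrees in a host tree -/

namespace HostTree

variable {N : ℕ} (T : HostTree N)

/-- The distance of a node from the root. -/
def depth (x : Fin N) : ℕ := Nat.find (T.reaches_root x)

theorem iterate_root (k : ℕ) : T.parent^[k] T.root = T.root :=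
  Function.iterate_fixed T.parent_root k

/-- The root is fixed by `parent`, so the exponents that lead to the root are closed upwards, and
`depth` is the least of them. -/
theorem iterate_eq_root_iff {x : Fin N} {k : ℕ} : T.parent^[k] x = T.root ↔ T.depth x ≤ k := by
  constructor
  · exact fun h => Nat.find_min' _ h
  · intro h
    obtain ⟨j, rfl⟩ := Nat.exists_eq_add_of_le h
    rw [add_comm, Function.iterate_add_apply, depth, Nat.find_spec (T.reaches_root x),
      iterate_root]

/-- Truncated subtraction agrees with the convention that the root is its own parent. -/
theorem depth_iterate (x : Fin N) (k : ℕ) : T.depth (T.parent^[k] x) = T.depth x - k := by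
  refine le_antisymm ?_ ?_
  · rw [← iterate_eq_root_iff, ← Function.iterate_add_apply, iterate_eq_root_iff]
    omega
  · have h := (T.iterate_eq_root_iff (x := T.parent^[k] x)).2 le_rfl
    rw [← Function.iterate_add_apply, iterate_eq_root_iff] at h
    omega

theorem depth_parent (x : Fin N) : T.depth (T.parent x) = T.depth x - 1 := T.depth_iterate x 1

theorem depth_eq_zero {x : Fin N} : T.depth x = 0 ↔ x = T.root := by
  rw [← Nat.le_zero, ← iterate_eq_root_iff, Function.iterate_zero, id]

/-- The nodes from `x` up to the root have distinct depths, so they are `depth x + 1` distinct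
nodes. -/
theorem depth_lt (x : Fin N) : T.depth x < N := by
  have hinj : Function.Injective fun k : Fin (T.depth x + 1) => T.parent^[k] x := by
    intro a b hab
    have h := congrArg T.depth hab
    simp only [depth_iterate] at h
    ext
    omega
  simpa using Fintype.card_le_of_injective _ hinj

variable {T}

theorem Desc.refl (x : Fin N) : T.Desc x x := ⟨0, rfl⟩

theorem Desc.trans {x y z : Fin N} (h₁ : T.Desc x y) (h₂ : T.Desc y z) : T.Desc x z := by
  obtain ⟨j, rfl⟩ := h₁
  obtain ⟨k, rfl⟩ := h₂
  exact ⟨k + j, Function.iterate_add_apply _ _ _ _⟩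

theorem Desc.depth_le {x y : Fin N} (h : T.Desc x y) : T.depth y ≤ T.depth x := by
  obtain ⟨k, rfl⟩ := h
  rw [depth_iterate]
  omega

theorem Desc.iterate_eq {x y : Fin N} (h : T.Desc x y) :
    T.parent^[T.depth x - T.depth y] x = y := by
  obtain ⟨k, rfl⟩ := h
  rw [depth_iterate]
  by_cases hk : k ≤ T.depth x
  · rw [Nat.sub_sub_self hk]
  · rw [Nat.sub_eq_zero_of_le (by omega : T.depth x ≤ k), Nat.sub_zero,
      T.iterate_eq_root_iff.2 le_rfl, T.iterate_eq_root_iff.2 (by omega : T.depth x ≤ k)]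

/-- The ancestors of `p` form a chain ordered by depth. -/
theorem Desc.of_depth_le {p x y : Fin N} (hx : T.Desc p x) (hy : T.Desc p y)
    (h : T.depth x ≤ T.depth y) : T.Desc y x := by
  refine ⟨T.depth y - T.depth x, ?_⟩
  have h₁ := hx.iterate_eq
  have h₂ := hy.iterate_eq
  have h₃ := hy.depth_le
  rw [← h₂, ← Function.iterate_add_apply, h₂, ← h₁]
  congr 1
  rw [h₁]
  omega

/-- A set of descendants of `t` that can be left from `t` only through the parent of `t`: if the
parent is outside the connected set `s`, or `t` is the root, then all of `s` is below `t`. -/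
theorem IsSubtree.desc_of_parent_notMem {s : Set (Fin N)} (hs : T.IsSubtree s) {t : Fin N}
    (ht : t ∈ s) (hp : T.parent t ∈ s → T.parent t = t) {x : Fin N} (hx : x ∈ s) :
    T.Desc x t := by
  obtain ⟨w⟩ := hs.preconnected ⟨t, ht⟩ ⟨x, hx⟩
  suffices H : ∀ (a b : s), (T.graph.induce s).Walk a b → T.Desc a t → T.Desc b t from
    H _ _ w (Desc.refl t)
  intro a b w
  induction w with
  | nil => exact id
  | cons hadj _ ih =>
    rename_i u v _ _
    intro hu
    refine ih ?_
    simp only [SimpleGraph.comap_adj, graph, SimpleGraph.fromRel_adj,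
      Function.Embedding.subtype_apply] at hadj
    -- A downward edge keeps the walk below `t`. An upward edge could leave the descendants of `t`
    -- only from `t` itself, where `hp` forbids it.
    rcases hadj with ⟨hne, h | h⟩
    · by_cases hut : (u : Fin N) = t
      · rw [hut] at h
        have := hp (h ▸ v.2)
        rw [← h, this]
        exact Desc.refl t
      · obtain ⟨k, hk⟩ := hu
        cases k with
        | zero => exact absurd hk hut
        | succ k => exact ⟨k, by rw [← h, ← Function.iterate_succ_apply]; exact hk⟩
    · exact Desc.trans ⟨1, h⟩ hu

/-- Otherwise `s` could not be left through the parent of `x`, so all of `s` would lie below `x`;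
but `t` is too shallow for that. -/
theorem IsSubtree.parent_mem {s : Set (Fin N)} (hs : T.IsSubtree s) {x t : Fin N} (hx : x ∈ s)
    (ht : t ∈ s) (h : T.depth t < T.depth x) : T.parent x ∈ s := by
  by_contra hp
  have := (hs.desc_of_parent_notMem hx (fun h' => absurd h' hp) ht).depth_le
  omega

variable (T) in
/-- The least depth of a node of `s`. -/
noncomputable def minDepth (s : Set (Fin N)) : ℕ := sInf (T.depth '' s)

theorem minDepth_le {s : Set (Fin N)} {x : Fin N} (hx : x ∈ s) : T.minDepth s ≤ T.depth x :=
  Nat.sInf_le (Set.mem_image_of_mem _ hx)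

theorem IsSubtree.nonempty {s : Set (Fin N)} (hs : T.IsSubtree s) : s.Nonempty :=
  Set.nonempty_coe_sort.1 (SimpleGraph.Connected.nonempty hs)

/-- A node of least depth in `s` has its parent in `s` only if it is the host root, so every node of
`s` lies below it. -/
theorem IsSubtree.exists_isRootOf {s : Set (Fin N)} (hs : T.IsSubtree s) :
    ∃ t, T.IsRootOf s t ∧ T.depth t = T.minDepth s := by
  obtain ⟨t, ht, htd⟩ := Nat.sInf_mem (hs.nonempty.image T.depth)
  refine ⟨t, ⟨ht, fun x hx => hs.desc_of_parent_notMem ht (fun hp => ?_) hx⟩, htd⟩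
  have h₁ : T.minDepth s ≤ T.depth (T.parent t) := minDepth_le hp
  rw [depth_parent, minDepth, ← htd] at h₁
  have h₂ : t = T.root := T.depth_eq_zero.1 (by omega)
  rw [h₂, T.parent_root]

/-- Climbing from a node of `s` stays inside `s` until the least depth of `s` is reached. -/
theorem IsSubtree.mem_of_desc {s : Set (Fin N)} (hs : T.IsSubtree s) {x y : Fin N} (hy : y ∈ s)
    (hyx : T.Desc y x) (hx : T.minDepth s ≤ T.depth x) : x ∈ s := by
  obtain ⟨t, ⟨ht, _⟩, htd⟩ := hs.exists_isRootOf
  obtain ⟨k, rfl⟩ := hyx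
  induction k generalizing y with
  | zero => exact hy
  | succ k ih =>
    rw [Function.iterate_succ_apply] at hx ⊢
    by_cases h : T.depth t < T.depth y
    · exact ih (hs.parent_mem hy ht h) hx
    · rw [← Function.iterate_succ_apply, depth_iterate] at hx
      -- Now `y` already has the least depth, and `hx` says that further parent steps do not go
      -- below it; only the root allows this.
      have : y = T.root := T.depth_eq_zero.1 (by
        have := minDepth_le (T := T) hy
        omega)
      subst this
      rwa [T.parent_root, iterate_root]

open Classical in
variable (T) in
/-- One more than the greatest depth of a node of `s` on the path from `p` to the root, and `0` if
there is none. -/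
noncomputable def reach (s : Set (Fin N)) (p : Fin N) : ℕ :=
  (Finset.range N).sup fun k => if T.parent^[k] p ∈ s then T.depth (T.parent^[k] p) + 1 else 0

/-- Taking the maximum over the first `N` iterates loses nothing, because all depths are below `N`.
The shift by one in `reach` leaves the value `0` for an empty intersection. -/
theorem lt_reach_iff {s : Set (Fin N)} {p : Fin N} {m : ℕ} :
    m < T.reach s p ↔ ∃ y ∈ s, T.Desc p y ∧ m ≤ T.depth y := by
  rw [reach, Finset.lt_sup_iff]
  constructor
  · rintro ⟨k, _, hk⟩
    split_ifs at hk with h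
    · exact ⟨_, h, ⟨k, rfl⟩, by omega⟩
    · omega
  · rintro ⟨y, hy, hpy, hm⟩
    have := T.depth_lt p
    refine ⟨T.depth p - T.depth y, Finset.mem_range.2 (by omega), ?_⟩
    rw [hpy.iterate_eq, if_pos hy]
    omega

theorem reach_le (s : Set (Fin N)) (p : Fin N) : T.reach s p ≤ N := by
  by_contra h
  obtain ⟨y, _, _, hy⟩ := lt_reach_iff.1 (not_le.1 h)
  have := T.depth_lt y
  omega

/-- On the path from `p` to the root a subtree occupies an interval of depths. For a node not above
its first level, membership is therefore one comparison with the lower end of the interval. -/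
theorem IsSubtree.mem_iff_lt_reach {s : Set (Fin N)} (hs : T.IsSubtree s) {p x : Fin N}
    (hpx : T.Desc p x) (hx : T.minDepth s ≤ T.depth x) : x ∈ s ↔ T.depth x < T.reach s p := by
  rw [lt_reach_iff]
  constructor
  · exact fun h => ⟨x, h, hpx, le_rfl⟩
  · rintro ⟨y, hy, hpy, h⟩
    exact hs.mem_of_desc hy (hpx.of_depth_le hpy h) hx

/-- This singles out the tips that matter for a vertex: a positive reach forces the tip to lie below
the root of the subtree. -/
theorem IsRootOf.desc_of_reach_pos {s : Set (Fin N)} {t p : Fin N} (ht : T.IsRootOf s t)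
    (h : 0 < T.reach s p) : T.Desc p t := by
  obtain ⟨y, hy, hpy, _⟩ := lt_reach_iff.1 h
  exact hpy.trans (ht.2 y hy)

/-- The nodes without children. -/
def IsTip (T : HostTree N) (p : Fin N) : Prop := ∀ y, T.parent y ≠ p

/-- Being its own parent, the root is never a tip, so it needs no separate exclusion. -/
theorem isLeafOf_univ_iff {p : Fin N} : T.IsLeafOf Set.univ p ↔ T.IsTip p := by
  constructor
  · exact fun h y => h.2.2 y trivial
  · refine fun h => ⟨trivial, fun hr => ?_, fun y _ => h y⟩
    obtain ⟨k, hk⟩ := hr.2 T.root trivial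
    rw [iterate_root] at hk
    exact h T.root (T.parent_root.trans hk)

/-- Take a deepest descendant of `x`: a child of it would be deeper, unless that child is the
self-parented root. The hypothesis on `N` is needed since a one-node tree has no tip. -/
theorem exists_tip_desc (hN : 1 < N) (x : Fin N) : ∃ p, T.IsTip p ∧ T.Desc p x := by
  classical
  obtain ⟨p, hp, hmax⟩ := (Finset.univ.filter fun y => T.Desc y x).exists_max_image T.depth
    ⟨x, by simpa using Desc.refl x⟩
  simp only [Finset.mem_filter, Finset.mem_univ, true_and] at hp hmax
  by_cases h : T.IsTip p
  · exact ⟨p, h, hp⟩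
  exfalso
  have key : ∀ y, T.parent y = p → y = T.root := by
    intro y hy
    have h₁ := hmax y (Desc.trans ⟨1, hy⟩ hp)
    rw [← hy, depth_parent] at h₁
    exact T.depth_eq_zero.1 (by omega)
  simp only [IsTip, ne_eq, not_forall, not_not] at h
  obtain ⟨y, hy⟩ := h
  have hy' := key y hy
  rw [hy', T.parent_root] at hy
  subst hy
  have : Nontrivial (Fin N) := Fin.nontrivial_iff_two_le.2 hN
  obtain ⟨u, hu⟩ := exists_ne T.root
  -- The root is now its own only child, whereas a node of positive depth would have an ancestor of
  -- depth one, which is another child.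
  have hd : ∀ u, T.depth u = 0 := by
    intro u
    by_contra hu
    have h₁ := T.depth_iterate u (T.depth u - 1)
    have h₂ : T.parent (T.parent^[T.depth u - 1] u) = T.root := by
      rw [← Function.iterate_succ_apply' T.parent, iterate_eq_root_iff]
      omega
    have h₃ := T.depth_eq_zero.2 (key _ h₂)
    omega
  exact hu (T.depth_eq_zero.1 (hd u))

end HostTree

/-! ### Cycles through terminals and triangles -/

namespace TreeModel

variable {n : ℕ} {G : SimpleGraph (Fin n)} {N : ℕ} (M : TreeModel G N)

/-- The depth of the root of the subtree of `v`. -/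
noncomputable def level (v : Fin n) : ℕ := M.host.minDepth (M.sub v)

variable {M}

/-- A common node lies below `t`, and the subtree of `u` starts no deeper than `t`, so climbing
within it passes through `t`. -/
theorem isRootOf_mem_of_adj {u v : Fin n} {t : Fin N} (ht : M.host.IsRootOf (M.sub v) t)
    (htd : M.host.depth t = M.level v) (hadj : G.Adj u v) (h : M.level u ≤ M.level v) :
    t ∈ M.sub u := by
  obtain ⟨y, hyu, hyv⟩ := (M.adj_iff u v hadj.ne).1 hadj
  exact (M.isSubtree u).mem_of_desc hyu (ht.2 y hyv) (h.trans htd.ge)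

/-- A vertex of greatest level is simplicial. -/
theorem adj_of_adj_of_level_le {a b v : Fin n} (hab : a ≠ b) (ha : G.Adj a v) (hb : G.Adj b v)
    (hla : M.level a ≤ M.level v) (hlb : M.level b ≤ M.level v) : G.Adj a b := by
  obtain ⟨t, ht, htd⟩ := (M.isSubtree v).exists_isRootOf
  exact (M.adj_iff a b hab).2
    ⟨t, isRootOf_mem_of_adj ht htd ha hla, isRootOf_mem_of_adj ht htd hb hlb⟩

end TreeModel

/-- No triangle within `Y` contains a vertex of `S`. -/
def NoTerminalTriangle {n : ℕ} (G : SimpleGraph (Fin n)) (S Y : Finset (Fin n)) : Prop :=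
  ∀ a ∈ Y, ∀ b ∈ Y, ∀ c ∈ Y, a ∈ S → G.Adj a b → G.Adj b c → G.Adj a c → False

/-- The relation whose chains are the walks within `Y`. -/
def AdjIn {n : ℕ} (G : SimpleGraph (Fin n)) (Y : Finset (Fin n)) (a b : Fin n) : Prop :=
  a ∈ Y ∧ b ∈ Y ∧ G.Adj a b

section Cycles

variable {n : ℕ} {G : SimpleGraph (Fin n)}

open Relation

/-- A walk avoids a simplicial vertex by joining its two neighbours on the walk directly. The second
part strengthens the induction: when the walk starts at `v`, any neighbour of `v` in `Y` can take
over as its start. -/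
theorem reflTransGen_adjIn_erase {Y : Finset (Fin n)} {v : Fin n}
    (hv : ∀ a ∈ Y, ∀ b ∈ Y, G.Adj a v → G.Adj b v → a ≠ b → G.Adj a b) {a w : Fin n}
    (h : ReflTransGen (AdjIn G Y) a w) (hw : w ≠ v) :
    (a ≠ v → ReflTransGen (AdjIn G (Y.erase v)) a w) ∧
    (a = v → ∀ b ∈ Y, G.Adj b v → ReflTransGen (AdjIn G (Y.erase v)) b w) := by
  induction h using ReflTransGen.head_induction_on with
  | refl => exact ⟨fun _ => .refl, fun h => absurd h hw⟩
  | head hac hcw ih =>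
    rename_i a c
    obtain ⟨haY, hcY, hadj⟩ := hac
    constructor
    · intro hav
      by_cases hcv : c = v
      · subst hcv
        exact ih.2 rfl a haY hadj
      · exact .head ⟨Finset.mem_erase.2 ⟨hav, haY⟩, Finset.mem_erase.2 ⟨hcv, hcY⟩, hadj⟩
          (ih.1 hcv)
    · rintro rfl b hbY hb
      have hca : c ≠ a := hadj.ne'
      by_cases hbc : b = c
      · subst hbc
        exact ih.1 hca
      · exact .head ⟨Finset.mem_erase.2 ⟨hb.ne, hbY⟩, Finset.mem_erase.2 ⟨hca, hcY⟩,
          hv b hbY c hcY hb hadj.symm hbc⟩ (ih.1 hca)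

/-- Induction on `Y`, removing a vertex `v` of greatest level in `Y` and `s` together, which is
simplicial there. If `v = s`, then `u` and `w` are adjacent. If `v` is an end of the walk, its
neighbour on the walk is also adjacent to `s`. Otherwise the walk is rerouted around `v`. -/
theorem exists_adj_neighbors {N : ℕ} (M : TreeModel G N) {s : Fin n} (m : ℕ)
    (Y : Finset (Fin n)) (hm : Y.card = m) {u w : Fin n} (huw : u ≠ w) (hs : s ∉ Y)
    (hu : u ∈ Y) (hw : w ∈ Y) (hsu : G.Adj s u) (hsw : G.Adj s w)
    (h : ReflTransGen (AdjIn G Y) u w) :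
    ∃ a ∈ Y, ∃ b ∈ Y, G.Adj s a ∧ G.Adj s b ∧ G.Adj a b := by
  induction m generalizing Y with
  | zero =>
    rw [Finset.card_eq_zero] at hm
    simp [hm] at hu
  | succ m ih =>
    obtain ⟨v, hv, hmax⟩ := (insert s Y).exists_max_image M.level ⟨s, Finset.mem_insert_self _ _⟩
    have hmax' : ∀ a ∈ Y, M.level a ≤ M.level v := fun a ha =>
      hmax a (Finset.mem_insert_of_mem ha)
    have hmaxs : M.level s ≤ M.level v := hmax s (Finset.mem_insert_self _ _)
    by_cases hvs : v = s
    · subst hvs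
      exact ⟨u, hu, w, hw, hsu, hsw,
        TreeModel.adj_of_adj_of_level_le huw hsu.symm hsw.symm (hmax' u hu) (hmax' w hw)⟩
    have hvY : v ∈ Y := (Finset.mem_insert.1 hv).resolve_left hvs
    by_cases hvu : v = u
    · subst hvu
      rcases ReflTransGen.cases_head h with h | ⟨c, ⟨_, hc, hvc⟩, _⟩
      · exact absurd h huw
      · refine ⟨v, hvY, c, hc, hsu, ?_, hvc⟩
        exact TreeModel.adj_of_adj_of_level_le (fun h => hs (h ▸ hc)) hsu hvc.symm hmaxs
          (hmax' c hc)
    by_cases hvw : v = w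
    · subst hvw
      rcases ReflTransGen.cases_tail h with h | ⟨c, _, ⟨hc, _, hcv⟩⟩
      · exact absurd h.symm huw
      · refine ⟨v, hvY, c, hc, hsw, ?_, hcv.symm⟩
        exact TreeModel.adj_of_adj_of_level_le (fun h => hs (h ▸ hc)) hsw hcv hmaxs (hmax' c hc)
    have hred := (reflTransGen_adjIn_erase (fun a ha b hb hav hbv hab =>
      TreeModel.adj_of_adj_of_level_le hab hav hbv (hmax' a ha) (hmax' b hb)) h
      (Ne.symm hvw)).1 (Ne.symm hvu)
    obtain ⟨a, ha, b, hb, h'⟩ := ih (Y.erase v) (by rw [Finset.card_erase_of_mem hvY, hm]; rfl)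
      (fun h => hs (Finset.mem_of_mem_erase h)) (Finset.mem_erase.2 ⟨Ne.symm hvu, hu⟩)
      (Finset.mem_erase.2 ⟨Ne.symm hvw, hw⟩) hred
    exact ⟨a, Finset.mem_of_mem_erase ha, b, Finset.mem_of_mem_erase hb, h'⟩

theorem reflTransGen_adjIn_of_walk {Y : Finset (Fin n)} {a b : Fin n} (p : G.Walk a b)
    (h : ∀ x ∈ p.support, x ∈ Y) : ReflTransGen (AdjIn G Y) a b := by
  induction p with
  | nil => exact .refl
  | cons hadj p ih =>
    refine .head ⟨h _ (by simp), h _ (by simp), hadj⟩ (ih fun x hx => h x ?_)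
    rw [SimpleGraph.Walk.support_cons]
    exact List.mem_cons_of_mem _ hx

/-- One direction reads a triangle as a cycle. For the other, a cycle rotated to start at its
terminal and stripped of the two edges there is a path that avoids the terminal and joins two of its
neighbours. -/
theorem isSubsetFVS_iff {N : ℕ} (M : TreeModel G N) (S X : Finset (Fin n)) :
    IsSubsetFVS G S X ↔ NoTerminalTriangle G S Xᶜ := by
  constructor
  · intro h a ha b hb c hc haS hab hbc hac
    rw [Finset.mem_compl] at ha hb hc
    obtain ⟨x, hx, hxs⟩ := h a (.cons hab (.cons hbc (.cons hac.symm .nil))) (by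
      simp [SimpleGraph.Walk.isCycle_def, SimpleGraph.Walk.isTrail_def, hab.ne, hab.ne',
        hbc.ne, hac.ne, hac.ne']) ⟨a, haS, by simp⟩
    simp only [SimpleGraph.Walk.support_cons, SimpleGraph.Walk.support_nil, List.mem_cons,
      List.not_mem_nil, or_false] at hxs
    rcases hxs with rfl | rfl | rfl | rfl
    all_goals contradiction
  · rintro h v c hc ⟨s, hsS, hsc⟩
    by_contra! hX
    have hc' := hc.rotate hsc
    have hX' : ∀ x ∈ (c.rotate s hsc).support, x ∉ X := by
      intro x hx hxX
      exact hX x hxX ((SimpleGraph.Walk.mem_support_rotate_iff c s hsc).1 hx)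
    generalize c.rotate s hsc = c' at hc' hX'
    cases c' with
    | nil => exact hc'.ne_nil rfl
    | cons hsu p =>
      rename_i u
      rw [SimpleGraph.Walk.cons_isCycle_iff] at hc'
      obtain ⟨hp, hedge⟩ := hc'
      -- Reversal brings the last edge of the cycle to the front, where it can be split off.
      have hpr := hp.reverse
      have hsupp : ∀ x ∈ p.reverse.support, x ∉ X := fun x hx => hX' x (by
        rw [SimpleGraph.Walk.support_reverse, List.mem_reverse] at hx
        rw [SimpleGraph.Walk.support_cons]
        exact List.mem_cons_of_mem _ hx)
      have hedge' : s(s, u) ∉ p.reverse.edges := by simpa using hedge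
      generalize p.reverse = q at hpr hsupp hedge'
      cases q with
      | nil => exact hsu.ne rfl
      | cons hsw q =>
        rename_i w
        rw [SimpleGraph.Walk.cons_isPath_iff] at hpr
        -- If they coincided, the cycle would use the edge between `s` and `u` twice.
        have hwu : w ≠ u := by
          rintro rfl
          simp at hedge'
        have hq : ∀ x ∈ q.support, x ∈ Xᶜ.erase s := by
          intro x hx
          refine Finset.mem_erase.2 ⟨fun h' => hpr.2 (h' ▸ hx), Finset.mem_compl.2 (hsupp x ?_)⟩
          rw [SimpleGraph.Walk.support_cons]
          exact List.mem_cons_of_mem _ hx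
        obtain ⟨a, ha, b, hb, hsa, hsb, hab⟩ := exists_adj_neighbors M _ (Xᶜ.erase s) rfl hwu
          (Finset.notMem_erase _ _) (hq w (by simp)) (hq u (by simp)) hsw hsu
          (reflTransGen_adjIn_of_walk q hq)
        exact h s (Finset.mem_compl.2 (hsupp s (by simp))) a (Finset.mem_of_mem_erase ha) b
          (Finset.mem_of_mem_erase hb) hsS hsa hab hsb

end Cycles

/-! ### The dynamic program

The vertices are processed in the order of their levels. For every tip `p` of the host tree, the
state holds the two largest labels among the vertices chosen so far, where the label of a vertex
tells how far down its subtree reaches on the path from the root to `p`, and whether it is a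
terminal. -/

/-- `s` consists of the two largest values of `z` on `Y` (or `0` in place of missing ones). -/
structure IsTopTwo {V : Type*} (Y : Finset V) (z : V → ℕ) (s : ℕ × ℕ) : Prop where
  le_fst : ∀ a ∈ Y, z a ≤ s.1
  le_snd : ∀ a ∈ Y, ∀ b ∈ Y, a ≠ b → min (z a) (z b) ≤ s.2
  fst_eq : s.1 = 0 ∨ ∃ a ∈ Y, z a = s.1
  snd_eq : s.2 = 0 ∨ ∃ a ∈ Y, ∃ b ∈ Y, a ≠ b ∧ z a = s.1 ∧ z b = s.2

/-- Insert a label into a pair of largest labels. -/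
def insertLabel (z : ℕ) (s : ℕ × ℕ) : ℕ × ℕ := (max s.1 z, max s.2 (min s.1 z))

theorem isTopTwo_empty {V : Type*} (z : V → ℕ) : IsTopTwo ∅ z (0, 0) :=
  ⟨by simp, by simp, .inl rfl, .inl rfl⟩

theorem IsTopTwo.insert {V : Type*} [DecidableEq V] {Y : Finset V} {z : V → ℕ} {s : ℕ × ℕ}
    (h : IsTopTwo Y z s) {v : V} (hv : v ∉ Y) :
    IsTopTwo (insert v Y) z (insertLabel (z v) s) := by
  obtain ⟨d, e⟩ := s
  obtain ⟨h₁, h₂, h₃, h₄⟩ := h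
  simp only at h₁ h₂ h₃ h₄
  refine ⟨?_, ?_, ?_, ?_⟩
  · intro a ha
    rcases Finset.mem_insert.1 ha with rfl | ha
    · exact le_max_right _ _
    · exact (h₁ a ha).trans (le_max_left _ _)
  · intro a ha b hb hab
    simp only [insertLabel]
    rcases Finset.mem_insert.1 ha with ha₁ | ha₁ <;>
      rcases Finset.mem_insert.1 hb with hb₁ | hb₁
    · exact absurd (ha₁.trans hb₁.symm) hab
    · have := h₁ b hb₁
      rw [ha₁]
      omega
    · have := h₁ a ha₁
      rw [hb₁]
      omega
    · have := h₂ a ha₁ b hb₁ hab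
      omega
  · rcases le_total d (z v) with hd | hd
    · exact .inr ⟨v, Finset.mem_insert_self _ _, by simp [insertLabel, hd]⟩
    · rcases h₃ with h₃ | ⟨a, ha, h₃⟩
      · exact .inl (by simp only [insertLabel]; omega)
      · exact .inr ⟨a, Finset.mem_insert_of_mem ha, by simp [insertLabel, hd, h₃]⟩
  · have hne : ∀ a ∈ Y, a ≠ v := fun a ha h => hv (h ▸ ha)
    -- That the pair is ordered is not part of `IsTopTwo`; it follows because the vertex attaining
    -- `e` also obeys the bound `d`.
    have key : ∀ a ∈ Y, ∀ b ∈ Y, a ≠ b → z a = d → z b = e → e ≤ d := by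
      intro a _ b hb _ _ hb'
      exact hb' ▸ h₁ b hb
    simp only [insertLabel]
    rcases le_total d (z v) with hd | hd
    · by_cases he : e ≤ d
      · rcases h₃ with h₃ | ⟨a, ha, h₃⟩
        · exact .inl (by omega)
        · exact .inr ⟨v, Finset.mem_insert_self _ _, a, Finset.mem_insert_of_mem ha,
            (hne a ha).symm, by omega, by omega⟩
      · rcases h₄ with h₄ | ⟨a, ha, b, hb, hab, ha', hb'⟩
        · omega
        · exact absurd (key a ha b hb hab ha' hb') he
    · rcases le_total e (z v) with he | he
      · rcases h₃ with h₃ | ⟨a, ha, h₃⟩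
        · exact .inl (by omega)
        · exact .inr ⟨a, Finset.mem_insert_of_mem ha, v, Finset.mem_insert_self _ _, hne a ha,
            by omega, by omega⟩
      · rcases h₄ with h₄ | ⟨a, ha, b, hb, hab, ha', hb'⟩
        · exact .inl (by omega)
        · exact .inr ⟨a, Finset.mem_insert_of_mem ha, b, Finset.mem_insert_of_mem hb, hab,
            by omega, by omega⟩

/-- The condition under which a vertex with label `z` (and with `c = 1` if it is a terminal, and
`c = 0` otherwise) may not be chosen, if the largest labels are `s` and the labels of the vertices
that contain its root are those above `m`. -/
def Blocked (m c z : ℕ) (s : ℕ × ℕ) : Prop := 0 < z ∧ m < s.2 ∧ 0 < c + s.1 % 2 + s.2 % 2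

instance (m c z : ℕ) (s : ℕ × ℕ) : Decidable (Blocked m c z s) :=
  inferInstanceAs (Decidable (_ ∧ _ ∧ _))

/-! ### States as numbers in base `B` -/

section Encoding

variable {ι : Type*} (B : ℕ)

/-- A family of pairs of numbers below `B`, encoded as one number. -/
def encodeState (s : ι → ℕ × ℕ) : List ι → ℕ
  | [] => 0
  | p :: l => ((s p).1 * B + (s p).2) * (B * B) ^ l.length + encodeState s l

/-- The code of a pair after the insertion of a label. -/
def insertCode (z q : ℕ) : ℕ :=
  (insertLabel z (q / B, q % B)).1 * B + (insertLabel z (q / B, q % B)).2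

/-- The code of the state after the insertion of a vertex with the labels `z`, and a number not
less than `W` if the insertion is blocked. -/
def nextCode (W m c : ℕ) (z : ι → ℕ) : List ι → ℕ → ℕ
  | [], _ => 0
  | p :: l, k =>
    (if Blocked m c (z p) (k / (B * B) ^ l.length / B, k / (B * B) ^ l.length % B) then W
      else insertCode B (z p) (k / (B * B) ^ l.length) * (B * B) ^ l.length) +
    nextCode W m c z l (k % (B * B) ^ l.length)

variable {B}

theorem pair_code_lt {d e : ℕ} (hd : d < B) (he : e < B) : d * B + e < B * B := by
  nlinarith

theorem encodeState_lt {s : ι → ℕ × ℕ} (hs : ∀ p, (s p).1 < B ∧ (s p).2 < B) (l : List ι) :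
    encodeState B s l < (B * B) ^ l.length := by
  induction l with
  | nil => simp [encodeState]
  | cons p l ih =>
    have h := pair_code_lt (hs p).1 (hs p).2
    rw [encodeState, List.length_cons, pow_succ']
    calc _ < ((s p).1 * B + (s p).2) * (B * B) ^ l.length + (B * B) ^ l.length := by omega
      _ = ((s p).1 * B + (s p).2 + 1) * (B * B) ^ l.length := by ring
      _ ≤ _ := Nat.mul_le_mul_right _ h

theorem encodeState_cons_div {s : ι → ℕ × ℕ} (hs : ∀ p, (s p).1 < B ∧ (s p).2 < B) (p : ι)
    (l : List ι) :
    encodeState B s (p :: l) / (B * B) ^ l.length = (s p).1 * B + (s p).2 := by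
  have h := encodeState_lt hs l
  rw [encodeState, add_comm, Nat.add_mul_div_right _ _ (by omega), Nat.div_eq_of_lt h, zero_add]

theorem encodeState_cons_mod {s : ι → ℕ × ℕ} (hs : ∀ p, (s p).1 < B ∧ (s p).2 < B) (p : ι)
    (l : List ι) :
    encodeState B s (p :: l) % (B * B) ^ l.length = encodeState B s l := by
  rw [encodeState, add_comm, Nat.add_mul_mod_self_right, Nat.mod_eq_of_lt (encodeState_lt hs l)]

theorem pair_code_div {d e : ℕ} (he : e < B) : (d * B + e) / B = d := by
  rw [add_comm, Nat.add_mul_div_right _ _ (by omega), Nat.div_eq_of_lt he, zero_add]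

theorem pair_code_mod {d e : ℕ} (he : e < B) : (d * B + e) % B = e := by
  rw [add_comm, Nat.add_mul_mod_self_right, Nat.mod_eq_of_lt he]

theorem nextCode_encodeState {W m c : ℕ} {z : ι → ℕ} {s : ι → ℕ × ℕ}
    (hs : ∀ p, (s p).1 < B ∧ (s p).2 < B) (l : List ι)
    (h : ∀ p ∈ l, ¬ Blocked m c (z p) (s p)) :
    nextCode B W m c z l (encodeState B s l) =
      encodeState B (fun p => insertLabel (z p) (s p)) l := by
  induction l with
  | nil => rfl
  | cons p l ih =>
    rw [nextCode, encodeState_cons_div hs, encodeState_cons_mod hs, pair_code_div (hs p).2,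
      pair_code_mod (hs p).2, if_neg (h p (by simp)), ih fun q hq => h q (by simp [hq]),
      insertCode, pair_code_div (hs p).2, pair_code_mod (hs p).2]
    rfl

/-- A blocked digit adds `W`, and the other contributions are natural numbers, so they cannot bring
the sum back below `W`. -/
theorem le_nextCode_encodeState {W m c : ℕ} {z : ι → ℕ} {s : ι → ℕ × ℕ}
    (hs : ∀ p, (s p).1 < B ∧ (s p).2 < B) (l : List ι)
    (h : ∃ p ∈ l, Blocked m c (z p) (s p)) :
    W ≤ nextCode B W m c z l (encodeState B s l) := by
  induction l with
  | nil => simp at h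
  | cons p l ih =>
    rw [nextCode, encodeState_cons_div hs, encodeState_cons_mod hs, pair_code_div (hs p).2,
      pair_code_mod (hs p).2]
    by_cases hp : Blocked m c (z p) (s p)
    · rw [if_pos hp]
      exact Nat.le_add_right _ _
    · refine (ih ?_).trans (Nat.le_add_left _ _)
      obtain ⟨q, hq, hq'⟩ := h
      rcases List.mem_cons.1 hq with rfl | hq
      · exact absurd hq' hp
      · exact ⟨q, hq, hq'⟩

end Encoding

/-! ### The recursion over the vertices -/

section DynamicProgram

variable {V : Type*} (W : ℕ) (next : V → ℕ → ℕ) (w : V → ℤ)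

/-- The best value obtained from a list of vertices to be processed, in the state with code `k`;
here `next v k` is the code after `v` is chosen, and `v` must not be chosen if this is at least
`W`. -/
def bestValue : List V → ℕ → ℤ
  | [], _ => 0
  | v :: l, k =>
    if next v k < W ∧ bestValue l k < w v + bestValue l (next v k) then
      w v + bestValue l (next v k)
    else bestValue l k

/-- The test whether the first vertex is chosen. -/
def Takes (v : V) (l : List V) (k : ℕ) : Prop :=
  next v k < W ∧ bestValue W next w l k < w v + bestValue W next w l (next v k)

noncomputable instance (v : V) (l : List V) (k : ℕ) : Decidable (Takes W next w v l k) :=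
  inferInstanceAs (Decidable (_ ∧ _))

/-- The chosen vertices. -/
noncomputable def chosenSet [DecidableEq V] : List V → ℕ → Finset V
  | [], _ => ∅
  | v :: l, k =>
    if Takes W next w v l k then insert v (chosenSet l (next v k)) else chosenSet l k

theorem chosenSet_subset [DecidableEq V] (l : List V) (k : ℕ) :
    chosenSet W next w l k ⊆ l.toFinset := by
  induction l generalizing k with
  | nil => simp [chosenSet]
  | cons v l ih =>
    rw [chosenSet, List.toFinset_cons]
    split_ifs
    · exact Finset.insert_subset_insert _ (ih _)
    · exact (ih _).trans (Finset.subset_insert _ _)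

theorem sum_chosenSet [DecidableEq V] (l : List V) (hl : l.Nodup) (k : ℕ) :
    ∑ v ∈ chosenSet W next w l k, w v = bestValue W next w l k := by
  induction l generalizing k with
  | nil => simp [chosenSet, bestValue]
  | cons v l ih =>
    rw [List.nodup_cons] at hl
    rw [chosenSet, bestValue]
    by_cases h : Takes W next w v l k
    · rw [if_pos h, if_pos (show _ ∧ _ from h), Finset.sum_insert, ih hl.2]
      exact fun hv => hl.1 (List.mem_toFinset.1 (chosenSet_subset W next w _ _ hv))
    · rw [if_neg h, if_neg (show ¬ (_ ∧ _) from h), ih hl.2]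

end DynamicProgram

/-! ### Correctness of states and recursion -/

section Correctness

variable {n : ℕ} {G : SimpleGraph (Fin n)} {N : ℕ}

theorem NoTerminalTriangle.mono {S Y Z : Finset (Fin n)} (h : NoTerminalTriangle G S Z)
    (hYZ : Y ⊆ Z) : NoTerminalTriangle G S Y :=
  fun a ha b hb c hc => h a (hYZ ha) b (hYZ hb) c (hYZ hc)

/-- The label of `v` for the tip `p`. -/
noncomputable def TreeModel.label (M : TreeModel G N) (S : Finset (Fin n)) (v : Fin n)
    (p : Fin N) : ℕ :=
  if M.host.reach (M.sub v) p = 0 then 0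
  else 2 * M.host.reach (M.sub v) p + if v ∈ S then 1 else 0

variable {M : TreeModel G N} {S : Finset (Fin n)}

theorem TreeModel.label_lt (v : Fin n) (p : Fin N) : M.label S v p < 2 * N + 2 := by
  have := HostTree.reach_le (T := M.host) (M.sub v) p
  rw [label]
  split_ifs <;> omega

/-- The terminal bit is the lowest bit of a label, and comparison with an odd threshold ignores it.
-/
theorem TreeModel.lt_label_iff {v : Fin n} {p : Fin N} {m : ℕ} :
    2 * m + 1 < M.label S v p ↔ m < M.host.reach (M.sub v) p := by
  rw [label]
  split_ifs <;> omega

theorem TreeModel.label_pos_iff {v : Fin n} {p : Fin N} :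
    0 < M.label S v p ↔ 0 < M.host.reach (M.sub v) p := by
  rw [label]
  split_ifs <;> omega

theorem TreeModel.label_odd_iff {v : Fin n} {p : Fin N} (h : 0 < M.label S v p) :
    M.label S v p % 2 = 1 ↔ v ∈ S := by
  rw [label] at h ⊢
  split_ifs at h ⊢ <;> simp_all

/-- For `a` no deeper than `v`, adjacency means that the subtree of `a` contains the root `t`, which
the interval criterion reads off at any tip below `t`. -/
theorem TreeModel.adj_iff_lt_label {a v : Fin n} {p t : Fin N} (hav : a ≠ v)
    (ht : M.host.IsRootOf (M.sub v) t) (htd : M.host.depth t = M.level v)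
    (hpt : M.host.Desc p t) (h : M.level a ≤ M.level v) :
    G.Adj a v ↔ 2 * M.level v + 1 < M.label S a p := by
  rw [lt_label_iff, ← htd, ← (M.isSubtree a).mem_iff_lt_reach hpt (h.trans htd.ge)]
  exact ⟨fun hadj => isRootOf_mem_of_adj ht htd hadj h,
    fun hmem => (M.adj_iff a v hav).2 ⟨t, hmem, ht.1⟩⟩

theorem noTerminalTriangle_insert_iff {Y : Finset (Fin n)} (hY : NoTerminalTriangle G S Y)
    {v : Fin n} :
    NoTerminalTriangle G S (insert v Y) ↔
      ∀ a ∈ Y, ∀ b ∈ Y, G.Adj a v → G.Adj b v → G.Adj a b → v ∉ S ∧ a ∉ S ∧ b ∉ S := by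
  constructor
  · intro h a ha b hb hav hbv hab
    have ha' := Finset.mem_insert_of_mem (a := a) (b := v) ha
    have hb' := Finset.mem_insert_of_mem (a := b) (b := v) hb
    have hv' := Finset.mem_insert_self v Y
    exact ⟨fun hS => h v hv' a ha' b hb' hS hav.symm hab hbv.symm,
      fun hS => h a ha' b hb' v hv' hS hab hbv hav,
      fun hS => h b hb' a ha' v hv' hS hab.symm hav hbv⟩
  · intro h a ha b hb c hc haS hab hbc hac
    rcases Finset.mem_insert.1 ha with rfl | ha₁
    · have hb₁ := (Finset.mem_insert.1 hb).resolve_left hab.ne'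
      have hc₁ := (Finset.mem_insert.1 hc).resolve_left hac.ne'
      exact (h b hb₁ c hc₁ hab.symm hac.symm hbc).1 haS
    · rcases Finset.mem_insert.1 hb with rfl | hb₁
      · have hc₁ := (Finset.mem_insert.1 hc).resolve_left hbc.ne'
        exact (h a ha₁ c hc₁ hab hbc.symm hac).2.1 haS
      · rcases Finset.mem_insert.1 hc with rfl | hc₁
        · exact (h a ha₁ b hb₁ hac hbc hab).2.1 haS
        · exact hY a ha₁ b hb₁ c hc₁ haS hab hbc hac

/-- The states describe exactly when a vertex may be added. -/
theorem exists_blocked_iff {Y : Finset (Fin n)} (hY : NoTerminalTriangle G S Y) {v : Fin n}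
    (hv : v ∉ Y) (hlev : ∀ a ∈ Y, M.level a ≤ M.level v) (hN : 1 < N) {tips : List (Fin N)}
    (htips : ∀ p, M.host.IsTip p → p ∈ tips) {s : Fin N → ℕ × ℕ}
    (hs : ∀ p, IsTopTwo Y (fun a => M.label S a p) (s p)) :
    (∃ p ∈ tips, Blocked (2 * M.level v + 1) (if v ∈ S then 1 else 0) (M.label S v p) (s p)) ↔
      ¬ NoTerminalTriangle G S (insert v Y) := by
  obtain ⟨t, ht, htd⟩ := (M.isSubtree v).exists_isRootOf
  rw [noTerminalTriangle_insert_iff hY]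
  have hne : ∀ a ∈ Y, a ≠ v := fun a ha h => hv (h ▸ ha)
  constructor
  · rintro ⟨p, -, hpos, hlt, hodd⟩ h
    -- The positive label puts `p` below `t`, so labels above the threshold belong to neighbours of
    -- `v`.
    have hpt : M.host.Desc p t := ht.desc_of_reach_pos (TreeModel.label_pos_iff.1 hpos)
    rcases (hs p).snd_eq with h0 | ⟨a, ha, b, hb, hab, ha', hb'⟩
    · omega
    have hle := (hs p).le_fst b hb
    have hav : G.Adj a v := (TreeModel.adj_iff_lt_label (hne a ha) ht htd hpt (hlev a ha)).2
      (by rw [ha']; omega)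
    have hbv : G.Adj b v := (TreeModel.adj_iff_lt_label (hne b hb) ht htd hpt (hlev b hb)).2
      (by rw [hb']; omega)
    have hadj := TreeModel.adj_of_adj_of_level_le hab hav hbv (hlev a ha) (hlev b hb)
    obtain ⟨hvS, haS, hbS⟩ := h a ha b hb hav hbv hadj
    rw [← TreeModel.label_odd_iff (M := M) (p := p) (by omega), ha'] at haS
    rw [← TreeModel.label_odd_iff (M := M) (p := p) (by omega), hb'] at hbS
    rw [if_neg hvS] at hodd
    omega
  · intro h
    -- Any tip below the root of the subtree of `v` detects the conflict.
    obtain ⟨p, hp, hpt⟩ := HostTree.exists_tip_desc (T := M.host) hN t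
    refine ⟨p, htips p hp, ?_⟩
    have hadj : ∀ a ∈ Y, G.Adj a v ↔ 2 * M.level v + 1 < M.label S a p := fun a ha =>
      TreeModel.adj_iff_lt_label (hne a ha) ht htd hpt (hlev a ha)
    have hpos : 0 < M.label S v p := by
      rw [TreeModel.label_pos_iff, HostTree.lt_reach_iff]
      exact ⟨t, ht.1, hpt, Nat.zero_le _⟩
    push Not at h
    obtain ⟨a, ha, b, hb, hav, hbv, hab, hSS⟩ := h
    have hsnd := (hs p).le_snd a ha b hb hab.ne
    have ha' := (hadj a ha).1 hav
    have hb' := (hadj b hb).1 hbv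
    refine ⟨hpos, by omega, ?_⟩
    by_cases hvS : v ∈ S
    · simp [hvS]
    obtain ⟨c, hc, hcv, hcS⟩ : ∃ c ∈ Y, G.Adj c v ∧ c ∈ S := by
      by_cases haS : a ∈ S
      · exact ⟨a, ha, hav, haS⟩
      · exact ⟨b, hb, hbv, hSS hvS haS⟩
    have hc' := (hadj c hc).1 hcv
    rcases (hs p).snd_eq with h0 | ⟨a', ha'Y, b', hb'Y, hne', ha'd, hb'e⟩
    · omega
    have hb'd := (hs p).le_fst b' hb'Y
    have hcodd := (TreeModel.label_odd_iff (M := M) (p := p) (by omega)).2 hcS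
    by_cases h₁ : c = a'
    · rw [h₁, ha'd] at hcodd
      omega
    by_cases h₂ : c = b'
    · rw [h₂, hb'e] at hcodd
      omega
    -- A terminal neighbour `c` besides the two top vertices would form a terminal triangle with
    -- them inside `Y`.
    exfalso
    have ha'v := (hadj a' ha'Y).2 (by omega)
    have hb'v := (hadj b' hb'Y).2 (by omega)
    have hl := hlev c hc
    exact hY c hc a' ha'Y b' hb'Y hcS
      (TreeModel.adj_of_adj_of_level_le h₁ hcv ha'v (hlev c hc) (hlev a' ha'Y))
      (TreeModel.adj_of_adj_of_level_le hne' ha'v hb'v (hlev a' ha'Y) (hlev b' hb'Y))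
      (TreeModel.adj_of_adj_of_level_le h₂ hcv hb'v (hlev c hc) (hlev b' hb'Y))

/-- The code of the next state, if the vertex `v` is chosen. -/
noncomputable def TreeModel.next (M : TreeModel G N) (S : Finset (Fin n)) (tips : List (Fin N))
    (v : Fin n) : ℕ → ℕ :=
  nextCode (2 * N + 2) (((2 * N + 2) * (2 * N + 2)) ^ tips.length) (2 * M.level v + 1)
    (if v ∈ S then 1 else 0) (M.label S v) tips

/-- The code depends on `Y` only through the two largest labels for every tip, which is all that
feasibility of later vertices depends on. So the induction runs over arbitrary processed sets `Y`
with a matching state, and its hypothesis is used both for `Y` and for `insert v Y`. -/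
theorem chosenSet_optimal (hN : 1 < N) {tips : List (Fin N)}
    (htips : ∀ p, M.host.IsTip p → p ∈ tips) (w : Fin n → ℤ) (l : List (Fin n)) (hnd : l.Nodup)
    (hsort : l.Pairwise fun a b => M.level a ≤ M.level b) (Y : Finset (Fin n))
    (hY : NoTerminalTriangle G S Y) (hYl : ∀ a ∈ Y, ∀ b ∈ l, a ≠ b ∧ M.level a ≤ M.level b)
    (s : Fin N → ℕ × ℕ) (hs : ∀ p, IsTopTwo Y (fun a => M.label S a p) (s p))
    (hsB : ∀ p, (s p).1 < 2 * N + 2 ∧ (s p).2 < 2 * N + 2) :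
    NoTerminalTriangle G S (Y ∪ chosenSet (((2 * N + 2) * (2 * N + 2)) ^ tips.length)
      (M.next S tips) w l (encodeState (2 * N + 2) s tips)) ∧
    ∀ Z ⊆ l.toFinset, NoTerminalTriangle G S (Y ∪ Z) →
      ∑ v ∈ Z, w v ≤ bestValue (((2 * N + 2) * (2 * N + 2)) ^ tips.length)
        (M.next S tips) w l (encodeState (2 * N + 2) s tips) := by
  induction l generalizing Y s with
  | nil =>
    simp only [chosenSet, bestValue, Finset.union_empty, List.toFinset_nil, Finset.subset_empty]
    exact ⟨hY, by rintro _ rfl _; simp⟩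
  | cons v l ih =>
    rw [List.nodup_cons] at hnd
    rw [List.pairwise_cons] at hsort
    have hvY : v ∉ Y := fun h => (hYl v h v (by simp)).1 rfl
    have hlev : ∀ a ∈ Y, M.level a ≤ M.level v := fun a ha => (hYl a ha v (by simp)).2
    have hblock := exists_blocked_iff hY hvY hlev hN htips hs
    obtain ⟨hs₁, hs₂⟩ := ih hnd.2 hsort.2 Y hY (fun a ha b hb => hYl a ha b (by simp [hb])) s hs hsB
    have hskip : ∀ Z ⊆ (v :: l).toFinset, v ∉ Z → Z ⊆ l.toFinset := by
      intro Z hZ hv a ha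
      have := hZ ha
      rw [List.toFinset_cons, Finset.mem_insert] at this
      exact this.resolve_left fun h => hv (h ▸ ha)
    by_cases hv : NoTerminalTriangle G S (insert v Y)
    · have hnb := fun p hp hb => (hblock.1 ⟨p, hp, hb⟩) hv
      have hnext := nextCode_encodeState (W := ((2 * N + 2) * (2 * N + 2)) ^ tips.length) hsB
        tips hnb
      have hsB' : ∀ p, (insertLabel (M.label S v p) (s p)).1 < 2 * N + 2 ∧
          (insertLabel (M.label S v p) (s p)).2 < 2 * N + 2 := by
        intro p
        have h₁ := hsB p
        have h₂ := TreeModel.label_lt (M := M) (S := S) v p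
        simp only [insertLabel]
        omega
      obtain ⟨ht₁, ht₂⟩ := ih hnd.2 hsort.2 (insert v Y) hv (by
        intro a ha b hb
        rcases Finset.mem_insert.1 ha with rfl | ha
        · exact ⟨fun h => hnd.1 (h ▸ hb), hsort.1 b hb⟩
        · exact hYl a ha b (by simp [hb])) _ (fun p => (hs p).insert hvY) hsB'
      have hlt := encodeState_lt hsB' tips
      have hnext' : M.next S tips v (encodeState (2 * N + 2) s tips) = _ := hnext
      rw [← hnext'] at ht₁ ht₂ hlt
      constructor
      · rw [chosenSet]
        split_ifs with htake
        · rwa [Finset.union_insert, ← Finset.insert_union]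
        · exact hs₁
      · intro Z hZ hgood
        rw [bestValue]
        -- A competitor either omits `v` or contains it; the recursion takes the larger of the two
        -- bounds.
        have hle : ∑ a ∈ Z, w a ≤ bestValue (((2 * N + 2) * (2 * N + 2)) ^ tips.length)
              (M.next S tips) w l (encodeState (2 * N + 2) s tips) ∨
            ∑ a ∈ Z, w a ≤ w v + bestValue (((2 * N + 2) * (2 * N + 2)) ^ tips.length)
              (M.next S tips) w l (M.next S tips v (encodeState (2 * N + 2) s tips)) := by
          by_cases hvZ : v ∈ Z
          · right
            rw [← Finset.add_sum_erase _ _ hvZ]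
            refine add_le_add_right (ht₂ (Z.erase v) (hskip _ ((Finset.erase_subset _ _).trans hZ)
              (Finset.notMem_erase _ _)) ?_) _
            rwa [Finset.insert_union, ← Finset.union_insert, Finset.insert_erase hvZ]
          · exact .inl (hs₂ Z (hskip Z hZ hvZ) hgood)
        split_ifs with htake
        · have := htake.2
          omega
        · have := not_and.1 htake hlt
          omega
    · have hge := le_nextCode_encodeState (W := ((2 * N + 2) * (2 * N + 2)) ^ tips.length) hsB
        tips (hblock.2 hv)
      have hge' : _ ≤ M.next S tips v (encodeState (2 * N + 2) s tips) := hge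
      constructor
      · rw [chosenSet, if_neg fun h => absurd h.1 (not_lt.2 hge')]
        exact hs₁
      · intro Z hZ hgood
        rw [bestValue, if_neg fun h => absurd h.1 (not_lt.2 hge')]
        refine hs₂ Z (hskip Z hZ fun hvZ => hv (hgood.mono ?_)) hgood
        exact Finset.insert_subset (Finset.mem_union_right _ hvZ) Finset.subset_union_left

theorem encodeState_zero {ι : Type*} (B : ℕ) (l : List ι) :
    encodeState B (fun _ => (0, 0)) l = 0 := by
  induction l with
  | nil => rfl
  | cons p l ih => simp [encodeState, ih]

/-- The vertices that the dynamic program does not choose are an optimal solution. -/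
theorem isMinSubsetFVS_compl_chosenSet (hN : 1 < N) {tips : List (Fin N)}
    (htips : ∀ p, M.host.IsTip p → p ∈ tips) (w : Fin n → ℤ) (l : List (Fin n)) (hnd : l.Nodup)
    (hsort : l.Pairwise fun a b => M.level a ≤ M.level b) (hl : ∀ v, v ∈ l) :
    IsMinSubsetFVS G S w (chosenSet (((2 * N + 2) * (2 * N + 2)) ^ tips.length)
      (M.next S tips) w l 0)ᶜ := by
  obtain ⟨h₁, h₂⟩ := chosenSet_optimal (S := S) hN htips w l hnd hsort ∅
    (fun a ha => by simp at ha) (by simp) _ (fun p => isTopTwo_empty _) (by simp)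
  rw [encodeState_zero, Finset.empty_union] at h₁
  rw [encodeState_zero, ← sum_chosenSet _ _ _ l hnd] at h₂
  refine ⟨(isSubsetFVS_iff M _ _).2 (by rwa [compl_compl]), fun Z hZ => ?_⟩
  have h₃ := h₂ Zᶜ (fun v _ => by simp [hl v]) (by
    rw [Finset.empty_union]
    exact (isSubsetFVS_iff M _ _).1 hZ)
  -- A set and its complement have constant total weight, so keeping the most weight means deleting
  -- the least, whatever the signs.
  have h₄ := Finset.sum_add_sum_compl Z w
  have h₅ := Finset.sum_add_sum_compl (chosenSet (((2 * N + 2) * (2 * N + 2)) ^ tips.length)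
      (M.next S tips) w l 0) w
  omega

end Correctness

/-! ### The program: preparations -/

namespace LeafageSFVS

open RAMProg

/-- Read the sizes and the root. Register `0` holds `1` and register `1` holds `0` throughout. -/
def readInput : RAMProg := block [const 0 1, load 2 0 1, load 3 0 0, const 11 2, load 4 0 11]

/-- Store the depths of the nodes in array `7`. -/
def computeDepths : RAMProg := block [
  add 20 3 1,
  forDown 20 (block [
    add 21 20 1,
    const 22 0,
    add 23 3 1,
    forDown 23 (block [
      sub 24 21 4,
      .cond 24 (add 22 22 0) (block [sub 24 4 21, .cond 24 (add 22 22 0) skip]),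
      load 21 4 21]),
    store 7 20 22])]

/-- Mark the nodes that have children in array `8`. -/
def markParents : RAMProg := block [
  add 20 3 1,
  forDown 20 (block [load 21 4 20, store 8 21 0])]

/-- List the tips in array `9`, and count them in register `5`. -/
def listTips : RAMProg := block [
  add 20 3 1,
  forDown 20 (block [load 21 8 20, .cond 21 skip (block [store 9 5 20, add 5 5 0])])]

/-- Put the base `2 * N + 2` of the codes into register `6`, its square into register `7`, and the
number of codes into register `8`. -/
def computeSizes : RAMProg := block [
  add 6 3 3, add 6 6 0, add 6 6 0,
  const 7 0, add 20 6 1, addLoop 7 6 20,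
  const 8 1, add 20 5 1,
  forDown 20 (block [add 21 8 1, const 8 0, add 22 7 1, addLoop 8 21 22])]

/-- Store the parities of the numbers below `2 * N + 2` in array `10`. -/
def computeParities : RAMProg := block [
  add 20 3 0,
  forDown 20 (block [add 21 20 20, add 21 21 0, store 10 21 0])]

variable {n : ℕ} {G : SimpleGraph (Fin n)} {N : ℕ}

open Classical in
/-- The input is in the arrays and the sizes are in the registers. -/
structure Ready (M : TreeModel G N) (S : Finset (Fin n)) (w : Fin n → ℤ) (σ : RAMState) :
    Prop where
  one : σ.reg 0 = 1
  zero : σ.reg 1 = 0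
  size : σ.reg 2 = n
  nodes : σ.reg 3 = N
  root : σ.reg 4 = (M.host.root : ℕ)
  terminal : ∀ v : Fin n, σ.arr 2 v = if v ∈ S then 1 else 0
  weight : ∀ v : Fin n, σ.arr 3 v = w v
  parent : ∀ x : Fin N, σ.arr 4 x = (M.host.parent x : ℕ)
  member : ∀ (v : Fin n) (x : Fin N), σ.arr 5 (N * v + x) = if x ∈ M.sub v then 1 else 0

variable {M : TreeModel G N} {S : Finset (Fin n)} {w : Fin n → ℤ} {σ : RAMState}

theorem Ready.congr {τ : RAMState} (h : Ready M S w σ) (hr : ∀ r < 5, τ.reg r = σ.reg r)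
    (ha : ∀ a < 6, τ.arr a = σ.arr a) : Ready M S w τ where
  one := (hr 0 (by decide)).trans h.one
  zero := (hr 1 (by decide)).trans h.zero
  size := (hr 2 (by decide)).trans h.size
  nodes := (hr 3 (by decide)).trans h.nodes
  root := (hr 4 (by decide)).trans h.root
  terminal := by rw [ha 2 (by decide)]; exact h.terminal
  weight := by rw [ha 3 (by decide)]; exact h.weight
  parent := by rw [ha 4 (by decide)]; exact h.parent
  member := by rw [ha 5 (by decide)]; exact h.member

theorem Ready.frame {p : RAMProg} {τ : RAMState} (h : Ready M S w σ) (hF : Frame p σ τ)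
    (hr : ∀ r < 5, r ∉ p.regs) (ha : ∀ a < 6, a ∉ p.arrs) : Ready M S w τ :=
  h.congr (fun r h' => hF.1 r (hr r h')) (fun a h' => hF.2 a (ha a h'))

theorem wp_readInput (M : TreeModel G N) (S : Finset (Fin n)) (w : Fin n → ℤ) :
    wp readInput (inputState G S w M) fun τ t =>
      t ≤ 5 ∧ Ready M S w τ ∧ (∀ a, 6 ≤ a → ∀ i, τ.arr a i = 0) ∧
      τ.reg 5 = 0 ∧ τ.reg 9 = 0 ∧ τ.reg 10 = 0 := by
  have hrest : ∀ a, 6 ≤ a → ∀ i, inputArr G S w M a i = 0 := by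
    intro a ha i
    obtain ⟨a, rfl⟩ := Nat.exists_eq_add_of_le ha
    rw [add_comm]
    rfl
  have hread : wp readInput (inputState G S w M) fun τ t =>
      t ≤ 5 ∧ τ.arr = inputArr G S w M ∧ τ.reg 0 = 1 ∧ τ.reg 1 = 0 ∧ τ.reg 2 = n ∧
      τ.reg 3 = N ∧ τ.reg 4 = (M.host.root : ℕ) ∧ τ.reg 5 = 0 ∧ τ.reg 9 = 0 ∧ τ.reg 10 = 0 := by
    simp [readInput, inputState]
    exact ⟨rfl, rfl, rfl⟩
  refine wp_mono hread fun τ t _ => ?_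
  rintro ⟨ht, ha, h0, h1, h2, h3, h4, h5, h9, h10⟩
  refine ⟨ht, ⟨h0, h1, h2, h3, h4, ?_, ?_, ?_, ?_⟩, by rw [ha]; exact hrest, h5, h9, h10⟩
  · intro v
    rw [ha, inputArr]
    congr 1
    simp [← Fin.ext_iff]
  · intro v
    simp [ha, inputArr]
  · intro x
    simp [ha, inputArr]
  · intro v x
    rw [ha, inputArr]
    congr 1
    rw [eq_iff_iff]
    constructor
    · rintro ⟨v', x', hx', heq⟩
      have hN : 0 < N := x.pos
      -- The row-major index determines its column modulo `N`, and then its row.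
      have h₁ : (x : ℕ) = x' := by
        have := congrArg (· % N) heq
        simpa [Nat.mod_eq_of_lt] using this
      have h₂ : (v : ℕ) = v' := by
        rw [h₁] at heq
        exact Nat.eq_of_mul_eq_mul_left hN (by omega)
      rwa [Fin.ext h₁, Fin.ext h₂]
    · exact fun h => ⟨v, x, h, rfl⟩

/-- The inner loop follows `N` parent steps and counts the visited nodes other than the root; the
count is the depth because depths are below `N`. -/
theorem wp_computeDepths (h : Ready M S w σ) :
    wp computeDepths σ fun τ t =>
      t ≤ 1 + (N * (N * 9 + 8 + 2) + 1) ∧ ∀ x : Fin N, τ.arr 7 x = M.host.depth x := by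
  simp only [computeDepths, wp_block_cons, wp_block_singleton, wp_add, h.nodes, h.zero, add_zero]
  refine wp_forDown N (N * 9 + 8)
    (fun i ρ => ∀ x : Fin N, i ≤ x → ρ.arr 7 x = M.host.depth x) (by simp) (by simp [h.one])
    (by decide) (by decide) (fun x hx => absurd x.2 (by omega)) ?_ ?_
  · intro i hi ρ hF hI
    have hρ := (h.congr (τ := σ.setReg 20 N) (by intro r hr; simp; omega) (by simp)).frame hF
      (by decide) (by decide)
    simp [hρ.nodes, hρ.zero]
    refine wp_forDown N 7
      (fun j τ => τ.reg 21 = (M.host.parent^[N - j] ⟨i, hi⟩ : Fin N) ∧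
        ∃ c : ℕ, τ.reg 22 = c ∧ c = min (N - j) (M.host.depth ⟨i, hi⟩)) (by simp) (by simp [hρ.one])
      (by decide) (by decide) (by simp) ?_ ?_
    · rintro j hj τ hF' ⟨h₁, c, h₂, hc⟩
      have hτ := (hρ.congr (τ := (((ρ.setReg 20 i).setReg 21 i).setReg 22 0).setReg 23 N)
        (by intro r hr; simp; omega) (by simp)).frame hF' (by decide) (by decide)
      obtain ⟨k, hk₁, hk₂⟩ : ∃ k, N - j = k + 1 ∧ N - (j + 1) = k :=
        ⟨N - (j + 1), by omega, rfl⟩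
      have hd := M.host.iterate_eq_root_iff (x := ⟨i, hi⟩) (k := k)
      rw [hk₂] at h₁ hc
      rw [hk₁, Function.iterate_succ_apply']
      simp [h₁, h₂, hτ.root, hτ.one, hτ.parent]
      rw [Fin.ext_iff] at hd
      omega
    · rintro τ t hF' ⟨h₁, c, h₂, hc⟩ ht
      have hlt := M.host.depth_lt ⟨i, hi⟩
      have h20 := hF'.1 20 (by decide)
      have ha7 := hF'.2 7 (by decide)
      simp at h20 h₂ ha7
      simp [h20, h₂, ha7]
      refine ⟨by omega, fun x hx => ?_⟩
      split_ifs with hxi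
      · obtain rfl : x = ⟨i, hi⟩ := Fin.ext hxi
        omega
      · exact hI x (by omega)
  · intro τ t hF hI ht
    exact ⟨by omega, fun x => hI x (Nat.zero_le _)⟩

-- The root marks itself as a parent, in accordance with `IsTip`.
open Classical in
theorem wp_markParents (h : Ready M S w σ) (h8 : ∀ i, σ.arr 8 i = 0) :
    wp markParents σ fun τ t =>
      t ≤ 1 + (N * (2 + 2) + 1) ∧ ∀ x : Fin N, τ.arr 8 x = if M.host.IsTip x then 0 else 1 := by
  simp only [markParents, wp_block_cons, wp_block_singleton, wp_add, h.nodes, h.zero, add_zero]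
  refine wp_forDown N 2
    (fun i ρ => ∀ x : Fin N, ρ.arr 8 x = if ∃ y : Fin N, i ≤ y ∧ M.host.parent y = x then 1 else 0)
    (by simp) (by simp [h.one]) (by decide) (by decide) ?_ ?_ ?_
  · intro x
    rw [if_neg (by rintro ⟨y, hy, _⟩; have := y.2; omega)]
    exact h8 x
  · intro i hi ρ hF hI
    have hρ := (h.congr (τ := σ.setReg 20 N) (by intro r hr; simp; omega) (by simp)).frame hF
      (by decide) (by decide)
    have hp := hρ.parent ⟨i, hi⟩
    simp only at hp
    simp [hp, hρ.one]
    intro x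
    by_cases hx : (x : ℕ) = M.host.parent ⟨i, hi⟩
    · rw [if_pos hx, if_pos ⟨⟨i, hi⟩, le_rfl, (Fin.ext hx).symm⟩]
    · rw [if_neg hx, hI x]
      congr 1
      rw [eq_iff_iff]
      constructor
      · rintro ⟨y, hy, hyx⟩
        exact ⟨y, by omega, hyx⟩
      · rintro ⟨y, hy, hyx⟩
        refine ⟨y, Nat.lt_of_le_of_ne hy fun hiy => hx ?_, hyx⟩
        rw [← hyx]
        congr 2
        exact Fin.ext hiy.symm
  · intro τ t hF hI ht
    refine ⟨by omega, fun x => ?_⟩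
    rw [hI x]
    by_cases hx : M.host.IsTip x
    · rw [if_pos hx, if_neg (by rintro ⟨y, _, hy⟩; exact hx y hy)]
    · rw [if_neg hx, if_pos]
      simpa [HostTree.IsTip] using hx

open Classical in
theorem wp_listTips (h : Ready M S w σ)
    (h8 : ∀ x : Fin N, σ.arr 8 x = if M.host.IsTip x then 0 else 1) (h5 : σ.reg 5 = 0) :
    wp listTips σ fun τ t => t ≤ 1 + (N * (5 + 2) + 1) ∧
      ∃ tips : List (Fin N), tips.Nodup ∧ (∀ p, p ∈ tips ↔ M.host.IsTip p) ∧
        τ.reg 5 = tips.length ∧ ∀ (j : ℕ) (hj : j < tips.length), τ.arr 9 j = (tips[j] : ℕ) := by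
  simp only [listTips, wp_block_cons, wp_block_singleton, wp_add, h.nodes, h.zero, add_zero]
  refine wp_forDown N 5
    (fun i ρ => ∃ tips : List (Fin N), tips.Nodup ∧
      (∀ p, p ∈ tips ↔ M.host.IsTip p ∧ i ≤ p) ∧ ρ.reg 5 = tips.length ∧
      ∀ (j : ℕ) (hj : j < tips.length), ρ.arr 9 j = (tips[j] : ℕ))
    (by simp) (by simp [h.one]) (by decide) (by decide) ?_ ?_ ?_
  · refine ⟨[], by simp, fun p => ?_, by simp [h5], by simp⟩
    have := p.2
    simp
  · rintro i hi ρ hF ⟨tips, hnd, hmem, hlen, harr⟩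
    have hρ := (h.congr (τ := σ.setReg 20 N) (by intro r hr; simp; omega) (by simp)).frame hF
      (by decide) (by decide)
    have h8' : ρ.arr 8 i = if M.host.IsTip ⟨i, hi⟩ then 0 else 1 := by
      rw [hF.2 8 (by decide)]
      exact h8 ⟨i, hi⟩
    simp [h8', hρ.one, hlen]
    by_cases hx : M.host.IsTip ⟨i, hi⟩
    · simp only [hx, if_true, lt_irrefl, false_imp_iff, true_and, le_refl, true_imp_iff]
      refine ⟨tips ++ [⟨i, hi⟩], ?_, fun p => ?_, by simp, fun j hj => ?_⟩
      · simp [List.nodup_append, hnd]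
        intro a ha hai
        have := ((hmem a).1 ha).2
        rw [hai] at this
        simp at this
      · simp only [List.mem_append, hmem, List.mem_singleton, Fin.ext_iff]
        constructor
        · rintro (⟨h₁, h₂⟩ | h₁)
          · exact ⟨h₁, by omega⟩
          · obtain rfl : p = ⟨i, hi⟩ := Fin.ext h₁
            exact ⟨hx, le_rfl⟩
        · rintro ⟨h₁, h₂⟩
          by_cases hpi : (p : ℕ) = i
          · exact .inr hpi
          · exact .inl ⟨h₁, by omega⟩
      · simp only [List.length_append, List.length_singleton] at hj
        by_cases hj' : j = tips.length
        · subst hj'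
          simp
        · rw [if_neg hj', harr j (by omega), List.getElem_append_left]
    · simp only [hx, if_false, zero_lt_one, true_imp_iff]
      refine ⟨?_, by intro h'; omega⟩
      refine ⟨tips, hnd, fun p => ?_, rfl, harr⟩
      rw [hmem]
      constructor
      · rintro ⟨h₁, h₂⟩
        exact ⟨h₁, by omega⟩
      · rintro ⟨h₁, h₂⟩
        refine ⟨h₁, Nat.lt_of_le_of_ne h₂ fun hip => hx ?_⟩
        rwa [Fin.ext hip.symm (a := p) (b := ⟨i, hi⟩)] at h₁
  · rintro τ t hF ⟨tips, hnd, hmem, hlen, harr⟩ ht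
    exact ⟨by omega, tips, hnd, by simpa using hmem, hlen, harr⟩

/-- Products are repeated additions. The current power is added to itself as often as the fixed
factor `B * B` says, so the cost of a multiplication does not grow with the power. -/
theorem wp_computeSizes (h : Ready M S w σ) {r : ℕ} (hr : σ.reg 5 = r) :
    wp computeSizes σ fun τ t =>
      t ≤ 8 + 3 * (2 * N + 2) + (r * (3 * ((2 * N + 2) * (2 * N + 2)) + 4 + 2) + 1) ∧
      τ.reg 6 = (2 * N + 2 : ℕ) ∧ τ.reg 7 = ((2 * N + 2) * (2 * N + 2) : ℕ) ∧
      τ.reg 8 = (((2 * N + 2) * (2 * N + 2)) ^ r : ℕ) := by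
  simp [computeSizes, h.nodes, h.zero, h.one]
  refine wp_addLoop (2 * N + 2) (by simp; ring) (by simp [h.one]) (by decide) ?_
  intro ρ t hF h7 ht
  have hρ : Ready M S w ρ := Ready.frame (h.congr (by intro r hr; simp; omega) (by simp)) hF
    (by decide) (by decide)
  have h5 := hF.1 5 (by decide)
  have h6 := hF.1 6 (by decide)
  simp at h5 h6 h7
  replace h7 : ρ.reg 7 = ((2 * N + 2) * (2 * N + 2) : ℕ) := by
    rw [h7]
    push_cast
    ring
  rw [h5, hr, hρ.zero]
  refine wp_forDown r (3 * ((2 * N + 2) * (2 * N + 2)) + 4)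
    (fun i τ => τ.reg 8 = (((2 * N + 2) * (2 * N + 2)) ^ (r - i) : ℕ)) (by simp)
    (by simp [hρ.one]) (by decide) (by decide) (by simp) ?_ ?_
  · intro i hi τ hF' hI
    have hτ := (hρ.congr (τ := ((ρ.setReg 8 1).setReg 20 r))
      (by intro r hr; simp; omega) (by simp)).frame hF' (by decide) (by decide)
    have h7' := hF'.1 7 (by decide)
    simp [h7] at h7'
    simp [hτ.zero, h7', hI]
    refine wp_addLoop ((2 * N + 2) * (2 * N + 2)) (by simp) (by simp [hτ.one])
      (by decide) ?_
    intro τ' t' _ h8 ht'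
    refine ⟨by omega, ?_⟩
    rw [h8]
    simp
    rw [show r - i = r - (i + 1) + 1 by omega, pow_succ]
    ring
  · intro τ t' hF' hI ht'
    have h6' := hF'.1 6 (by decide)
    have h7' := hF'.1 7 (by decide)
    simp [h6, h7] at h6' h7'
    refine ⟨by omega, ?_, ?_, by simpa using hI⟩
    · rw [h6']
      ring
    · rw [h7']

/-- Only the odd cells are written; the even ones keep their initial `0`. -/
theorem wp_computeParities (h : Ready M S w σ) (h10 : ∀ i, σ.arr 10 i = 0) :
    wp computeParities σ fun τ t => t ≤ 1 + ((N + 1) * (3 + 2) + 1) ∧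
      ∀ d < 2 * N + 2, τ.arr 10 d = (d % 2 : ℕ) := by
  simp [computeParities, h.nodes, h.one]
  refine wp_forDown (N + 1) 3
    (fun i ρ => ∀ d < 2 * N + 2, ρ.arr 10 d = if 2 * i ≤ d then ((d % 2 : ℕ) : ℤ) else 0)
    (by simp) (by simp [h.one]) (by decide) (by decide) ?_ ?_ ?_
  · intro d hd
    rw [if_neg (by omega)]
    exact h10 d
  · intro i hi ρ hF hI
    have hρ := (h.congr (τ := σ.setReg 20 (N + 1)) (by intro r hr; simp; omega) (by simp)).frame
      hF (by decide) (by decide)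
    have hc : ((i : ℤ) + i + 1).toNat = 2 * i + 1 := by omega
    simp [hρ.one, hc]
    intro d hd
    rw [hI d hd]
    by_cases hdi : d = 2 * i + 1
    · subst hdi
      simp
    · rw [if_neg hdi]
      by_cases hd2 : d = 2 * i
      · subst hd2
        simp
      · by_cases hd3 : 2 * (i + 1) ≤ d
        · rw [if_pos hd3, if_pos (by omega)]
          simp
        · rw [if_neg hd3, if_neg (by omega)]
  · intro τ t _ hI ht
    refine ⟨by omega, fun d hd => ?_⟩
    rw [hI d hd, if_pos (by omega)]
    simp

/-- All tables that do not depend on the vertex in turn have been computed. -/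
structure Prepared (M : TreeModel G N) (S : Finset (Fin n)) (w : Fin n → ℤ)
    (tips : List (Fin N)) (σ : RAMState) : Prop extends Ready M S w σ where
  tipCount : σ.reg 5 = tips.length
  base : σ.reg 6 = (2 * N + 2 : ℕ)
  codeCount : σ.reg 8 = (((2 * N + 2) * (2 * N + 2)) ^ tips.length : ℕ)
  depth : ∀ x : Fin N, σ.arr 7 x = M.host.depth x
  tip : ∀ (j : ℕ) (hj : j < tips.length), σ.arr 9 j = (tips[j] : ℕ)
  parity : ∀ d < 2 * N + 2, σ.arr 10 d = (d % 2 : ℕ)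

theorem Prepared.congr {tips : List (Fin N)} {τ : RAMState} (h : Prepared M S w tips σ)
    (hr : ∀ r < 9, τ.reg r = σ.reg r) (ha : ∀ a < 11, a ≠ 6 → τ.arr a = σ.arr a) :
    Prepared M S w tips τ where
  toReady := h.toReady.congr (fun r h' => hr r (by omega)) (fun a h' => ha a (by omega) (by omega))
  tipCount := (hr 5 (by decide)).trans h.tipCount
  base := (hr 6 (by decide)).trans h.base
  codeCount := (hr 8 (by decide)).trans h.codeCount
  depth := by rw [ha 7 (by decide) (by decide)]; exact h.depth
  tip := by rw [ha 9 (by decide) (by decide)]; exact h.tip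
  parity := by rw [ha 10 (by decide) (by decide)]; exact h.parity

theorem Prepared.frame {tips : List (Fin N)} {p : RAMProg} {τ : RAMState}
    (h : Prepared M S w tips σ) (hF : Frame p σ τ) (hr : ∀ r < 9, r ∉ p.regs)
    (ha : ∀ a < 11, a ≠ 6 → a ∉ p.arrs) : Prepared M S w tips τ :=
  h.congr (fun r h' => hF.1 r (hr r h')) (fun a h' h'' => hF.2 a (ha a h' h''))

theorem Prepared.setReg {tips : List (Fin N)} (h : Prepared M S w tips σ) {d : ℕ} (hd : 9 ≤ d)
    (z : ℤ) : Prepared M S w tips (σ.setReg d z) :=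
  h.congr (fun r hr => by simp; omega) (fun _ _ _ => rfl)

/-- Everything that precedes the main loop. -/
def prepare : RAMProg :=
  block [readInput, computeDepths, markParents, listTips, computeSizes, computeParities]

/-- The zeros in registers `9` and `10` and in array `12` are retained because they already
represent the layer of the empty list. -/
theorem wp_prepare (M : TreeModel G N) (S : Finset (Fin n)) (w : Fin n → ℤ) :
    wp prepare (inputState G S w M) fun τ t =>
      ∃ tips : List (Fin N), tips.Nodup ∧ (∀ p, p ∈ tips ↔ M.host.IsTip p) ∧
        Prepared M S w tips τ ∧ τ.reg 9 = 0 ∧ τ.reg 10 = 0 ∧ (∀ i, τ.arr 12 i = 0) ∧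
        t ≤ 100 * (tips.length + 1) * (N + 1) ^ 2 := by
  simp only [prepare, wp_block_cons, wp_block_singleton]
  refine wp_mono (wp_readInput M S w) fun σ₁ t₁ _ ⟨ht₁, hR₁, hz, h5, h9, h10⟩ => ?_
  refine wp_mono (wp_computeDepths hR₁) fun σ₂ t₂ hF₂ ⟨ht₂, hdep⟩ => ?_
  have hR₂ := hR₁.frame hF₂ (by decide) (by decide)
  have hz₂ : ∀ a, 8 ≤ a → ∀ i, σ₂.arr a i = 0 := by
    intro a ha
    rw [hF₂.2 a (by simp [computeDepths, block, forDown, arrs]; omega)]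
    exact hz a (by omega)
  refine wp_mono (wp_markParents hR₂ (hz₂ 8 le_rfl)) fun σ₃ t₃ hF₃ ⟨ht₃, hmark⟩ => ?_
  have hR₃ := hR₂.frame hF₃ (by decide) (by decide)
  refine wp_mono (wp_listTips hR₃ hmark (by
    rw [hF₃.1 5 (by decide), hF₂.1 5 (by decide), h5])) fun σ₄ t₄ hF₄ ⟨ht₄, tips, hnd, hmem,
    hlen, harr⟩ => ?_
  have hR₄ := hR₃.frame hF₄ (by decide) (by decide)
  refine wp_mono (wp_computeSizes hR₄ hlen) fun σ₅ t₅ hF₅ ⟨ht₅, h6, h7, h8⟩ => ?_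
  have hR₅ := hR₄.frame hF₅ (by decide) (by decide)
  refine wp_mono (wp_computeParities hR₅ (by
    rw [hF₅.2 10 (by decide), hF₄.2 10 (by decide), hF₃.2 10 (by decide)]
    exact hz₂ 10 (by omega))) fun σ₆ t₆ hF₆ ⟨ht₆, hpar⟩ => ?_
  have hR₆ := hR₅.frame hF₆ (by decide) (by decide)
  refine ⟨tips, hnd, hmem, ⟨hR₆, ?_, ?_, ?_, ?_, ?_, hpar⟩, ?_, ?_, ?_, ?_⟩
  · rw [hF₆.1 5 (by decide), hF₅.1 5 (by decide), hlen]
  · rw [hF₆.1 6 (by decide), h6]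
  · rw [hF₆.1 8 (by decide), h8]
  · rw [hF₆.2 7 (by decide), hF₅.2 7 (by decide), hF₄.2 7 (by decide), hF₃.2 7 (by decide)]
    exact hdep
  · rw [hF₆.2 9 (by decide), hF₅.2 9 (by decide)]
    exact harr
  · rw [hF₆.1 9 (by decide), hF₅.1 9 (by decide), hF₄.1 9 (by decide), hF₃.1 9 (by decide),
      hF₂.1 9 (by decide), h9]
  · rw [hF₆.1 10 (by decide), hF₅.1 10 (by decide), hF₄.1 10 (by decide), hF₃.1 10 (by decide),
      hF₂.1 10 (by decide), h10]
  · rw [hF₆.2 12 (by decide), hF₅.2 12 (by decide), hF₄.2 12 (by decide), hF₃.2 12 (by decide)]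
    exact hz₂ 12 (by omega)
  · clear * - ht₁ ht₂ ht₃ ht₄ ht₅ ht₆
    generalize tips.length = r at *
    nlinarith [Nat.zero_le (r * N), Nat.zero_le (r * N ^ 2)]

end LeafageSFVS

/-! ### The program: levels, labels and codes -/

namespace LeafageSFVS

open RAMProg

/-- For the vertex `v` in register `21`, put `N * v` into register `22` and the level of `v` into
register `24`. -/
def computeLevel : RAMProg := block [
  const 22 0, add 23 21 1, addLoop 22 3 23,
  add 24 3 1, add 25 3 1,
  forDown 25 (block [
    add 26 22 25, load 26 5 26,
    .cond 26 (block [load 27 7 25, sub 28 24 27, .cond 28 (add 24 27 1) skip]) skip])]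

/-- For the tip whose position in the list of tips is in register `35`, put the label of the vertex
in turn into register `42`. -/
def computeLabel : RAMProg := block [
  load 36 9 35, const 37 0, add 38 3 1,
  forDown 38 (block [
    add 39 22 36, load 39 5 39,
    .cond 39 (block [load 40 7 36, add 40 40 0, sub 41 40 37, .cond 41 (add 37 40 1) skip]) skip,
    load 36 4 36]),
  add 42 37 37, .cond 37 (add 42 42 30) skip]

/-- Insert the label in register `42` into the pair in registers `47` and `48`; the result is in
registers `50` and `53`. -/
def insertPair : RAMProg := block [
  sub 52 47 42,
  .cond 52 (block [add 50 47 1, add 51 42 1]) (block [add 50 42 1, add 51 47 1]),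
  sub 52 48 51, .cond 52 (add 53 48 1) (add 53 51 1)]

/-- Put a positive number into register `54` if and only if the insertion is blocked. -/
def testBlocked : RAMProg := block [
  const 54 0,
  .cond 42 (block [
    sub 52 48 32,
    .cond 52 (block [load 55 10 47, load 56 10 48, add 55 55 56, add 54 55 30]) skip]) skip]

/-- Put the contribution of the pair in turn to the next code into register `49`. -/
def computeDigit : RAMProg := block [
  insertPair, testBlocked,
  .cond 54 (add 49 8 1) (block [const 49 0, addLoop 49 43 50, addLoop 49 34 53])]

/-- Fill the part of the table of next codes (array `11`) that belongs to the pair in turn. -/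
def fillBlock : RAMProg := block [
  add 57 34 1,
  forDown 57 (block [load 58 11 57, add 58 58 49, add 59 45 57, store 11 59 58])]

variable {n : ℕ} {G : SimpleGraph (Fin n)} {N : ℕ} {M : TreeModel G N} {S : Finset (Fin n)}
  {w : Fin n → ℤ} {tips : List (Fin N)} {σ : RAMState}

/-- The running minimum starts at `N`, above all depths. A subtree is nonempty, so the alternative
`c = N` in the invariant is excluded at the end. -/
theorem wp_computeLevel (h : Prepared M S w tips σ) {v : Fin n} (hv : σ.reg 21 = (v : ℕ)) :
    wp computeLevel σ fun τ t => t ≤ 3 * n + (N * (7 + 2) + 6) ∧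
      τ.reg 22 = (N * v : ℕ) ∧ τ.reg 24 = M.level v := by
  simp [computeLevel, hv, h.zero]
  refine wp_addLoop v (by simp) (by simp [h.one]) (by decide) ?_
  intro ρ t hF h22 ht
  have hρ : Prepared M S w tips ρ := Prepared.frame ((h.setReg (by decide) _).setReg (by decide) _)
    hF (by decide) (by decide)
  simp [h.nodes] at h22
  simp only [hρ.nodes, hρ.zero, add_zero]
  refine wp_forDown N 7
    (fun i τ => ∃ c : ℕ, τ.reg 24 = c ∧ (∀ x ∈ M.sub v, i ≤ x → c ≤ M.host.depth x) ∧
      (c = N ∨ ∃ x ∈ M.sub v, M.host.depth x = c)) (by simp) (by simp [hρ.one])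
    (by decide) (by decide) ?_ ?_ ?_
  · exact ⟨N, by simp, fun x _ hx => absurd x.2 (by omega), .inl rfl⟩
  · rintro i hi τ hF' ⟨c, hc, hle, hatt⟩
    have hτ : Prepared M S w tips τ :=
      Prepared.frame ((hρ.setReg (by decide) _).setReg (by decide) _) hF' (by decide) (by decide)
    have h22' := hF'.1 22 (by decide)
    simp [h22] at h22'
    have hmem := hτ.member v ⟨i, hi⟩
    have hdep := hτ.depth ⟨i, hi⟩
    have haddr : ((v : ℤ) * N + i).toNat = N * v + i := by
      rw [mul_comm (v : ℤ), ← Nat.cast_mul, ← Nat.cast_add, Int.toNat_natCast]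
    simp only at hmem hdep
    simp [h22', haddr, hmem, hdep, hc, hτ.zero]
    by_cases hx : (⟨i, hi⟩ : Fin N) ∈ M.sub v
    · simp only [hx, if_true, zero_lt_one, true_imp_iff]
      refine ⟨⟨fun hlt => ⟨fun x hx' hix => ?_, .inr ⟨_, hx, rfl⟩⟩,
        fun hge => ⟨fun x hx' hix => ?_, hatt⟩⟩, by intro h'; omega⟩
      · by_cases hxi : (x : ℕ) = i
        · obtain rfl : x = ⟨i, hi⟩ := Fin.ext hxi
          exact le_rfl
        · exact hlt.le.trans (hle x hx' (by omega))
      · by_cases hxi : (x : ℕ) = i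
        · obtain rfl : x = ⟨i, hi⟩ := Fin.ext hxi
          exact hge
        · exact hle x hx' (by omega)
    · simp only [hx, if_false, lt_irrefl, false_imp_iff, true_and, le_refl, true_imp_iff]
      refine ⟨fun x hx' hix => hle x hx' ?_, hatt⟩
      refine Nat.lt_of_le_of_ne hix fun hxi => hx ?_
      rwa [Fin.ext hxi.symm (a := x) (b := ⟨i, hi⟩)] at hx'
  · rintro τ t' hF' ⟨c, hc, hle, hatt⟩ ht'
    have h22' := hF'.1 22 (by decide)
    simp [h22] at h22'
    have hv' := v.2
    refine ⟨by omega, by rw [h22']; ring, ?_⟩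
    rw [hc]
    congr 1
    obtain ⟨x, hx, hxd⟩ := Nat.sInf_mem ((M.isSubtree v).nonempty.image M.host.depth)
    have hxd' : M.host.depth x = M.level v := hxd
    have h₁ := hle x hx (Nat.zero_le _)
    have h₂ := M.host.depth_lt x
    obtain ⟨y, hy, hyc⟩ := hatt.resolve_left (by omega)
    have h₃ : M.level v ≤ M.host.depth y := HostTree.minDepth_le hy
    omega

-- Walking up from the tip, the running maximum in register `37` follows the supremum that defines
-- `reach`, one iterate of `parent` at a time.
open Classical in
theorem wp_computeLabel (h : Prepared M S w tips σ) {v : Fin n} (h22 : σ.reg 22 = (N * v : ℕ))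
    (h30 : σ.reg 30 = if v ∈ S then 1 else 0) {j : ℕ} (hj : j < tips.length)
    (h35 : σ.reg 35 = j) :
    wp computeLabel σ fun τ t => t ≤ N * (9 + 2) + 7 ∧ τ.reg 42 = M.label S v tips[j] := by
  have h9 := h.tip j hj
  simp [computeLabel, h35, h.zero, h.nodes, h9]
  refine wp_forDown N 9
    (fun i τ => τ.reg 36 = (M.host.parent^[N - i] tips[j] : Fin N) ∧
      ∃ c : ℕ, τ.reg 37 = c ∧ c = (Finset.range (N - i)).sup fun k =>
        if M.host.parent^[k] tips[j] ∈ M.sub v then M.host.depth (M.host.parent^[k] tips[j]) + 1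
        else 0) (by simp) (by simp [h.one])
    (by decide) (by decide) (by simp) ?_ ?_
  · rintro i hi τ hF ⟨h36, c, hc, hsup⟩
    have hτ : Prepared M S w tips τ := Prepared.frame
      (((h.setReg (by decide) _).setReg (by decide) _).setReg (by decide) _) hF
      (by decide) (by decide)
    have h22' := hF.1 22 (by decide)
    simp only [RAMState.setReg_reg, h22] at h22'
    obtain ⟨k, hk₁, hk₂⟩ : ∃ k, N - i = k + 1 ∧ N - (i + 1) = k :=
      ⟨N - (i + 1), by omega, rfl⟩
    rw [hk₂] at h36 hsup
    rw [hk₁, Function.iterate_succ_apply', Finset.range_add_one, Finset.sup_insert, ← hsup]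
    generalize M.host.parent^[k] tips[j] = y at *
    have hmem := hτ.member v y
    have haddr : ((N : ℤ) * v + y).toNat = N * v + y := by
      rw [← Nat.cast_mul, ← Nat.cast_add, Int.toNat_natCast]
    simp [h22', h36, haddr, hmem, hτ.depth, hτ.parent, hτ.one, hc, hτ.zero]
    by_cases hy : y ∈ M.sub v
    · simp [hy]
      omega
    · simp [hy]
  · rintro τ t hF ⟨-, c, hc, hsup⟩ ht
    have h30' := hF.1 30 (by decide)
    simp only [RAMState.setReg_reg, h30] at h30'
    simp at h30'
    have hreach : c = M.host.reach (M.sub v) tips[j] := by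
      rw [hsup, Nat.sub_zero]
      rfl
    simp [hc, h30', TreeModel.label, ← hreach]
    refine ⟨fun hpos => ⟨by omega, ?_⟩, fun h0 => ⟨by omega, by simp [h0]⟩⟩
    rw [if_neg hpos.ne']
    ring

theorem wp_insertPair (h1 : σ.reg 1 = 0) {d e z : ℕ} (hd : σ.reg 47 = d) (he : σ.reg 48 = e)
    (hz : σ.reg 42 = z) :
    wp insertPair σ fun τ t => t ≤ 7 ∧ τ.reg 50 = ((insertLabel z (d, e)).1 : ℕ) ∧
      τ.reg 53 = ((insertLabel z (d, e)).2 : ℕ) := by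
  simp [insertPair, hd, he, hz, h1, insertLabel]
  omega

theorem wp_testBlocked {d e z m c B : ℕ} (hd : σ.reg 47 = d)
    (he : σ.reg 48 = e) (hz : σ.reg 42 = z) (hm : σ.reg 32 = m) (hc : σ.reg 30 = c)
    (hdB : d < B) (heB : e < B) (hpar : ∀ d < B, σ.arr 10 d = (d % 2 : ℕ)) :
    wp testBlocked σ fun τ t => t ≤ 8 ∧ (0 < τ.reg 54 ↔ Blocked m c z (d, e)) := by
  simp [testBlocked, hd, he, hz, hm, hc, hpar d hdB, hpar e heB, Blocked]
  omega

/-- The product is formed by adding `B * L` and `L`, at most `B` times each, so the cost is linear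
in `B` and independent of `L`. -/
theorem wp_computeDigit (h : Prepared M S w tips σ) {d e z m c L : ℕ} (hd : σ.reg 47 = d)
    (he : σ.reg 48 = e) (hz : σ.reg 42 = z) (hm : σ.reg 32 = m) (hc : σ.reg 30 = c)
    (hL : σ.reg 34 = L) (hBL : σ.reg 43 = ((2 * N + 2) * L : ℕ))
    (hdB : d < 2 * N + 2) (heB : e < 2 * N + 2) (hzB : z < 2 * N + 2) :
    wp computeDigit σ fun τ t => t ≤ 6 * (2 * N + 2) + 20 ∧
      τ.reg 49 = ((if Blocked m c z (d, e) then ((2 * N + 2) * (2 * N + 2)) ^ tips.length else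
        ((insertLabel z (d, e)).1 * (2 * N + 2) + (insertLabel z (d, e)).2) * L : ℕ) : ℤ) := by
  simp only [computeDigit, wp_block_cons, wp_block_singleton]
  refine wp_mono (wp_insertPair h.zero hd he hz) fun ρ t hF ⟨ht, h50, h53⟩ => ?_
  have hρ : Prepared M S w tips ρ := h.frame hF (by decide) (by decide)
  refine wp_mono (wp_testBlocked (B := 2 * N + 2) (m := m) (c := c) (z := z) (by rw [hF.1 47 (by decide), hd])
    (by rw [hF.1 48 (by decide), he]) (by rw [hF.1 42 (by decide), hz])
    (by rw [hF.1 32 (by decide), hm]) (by rw [hF.1 30 (by decide), hc]) hdB heB hρ.parity)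
    fun ρ' t' hF' ⟨ht', h54⟩ => ?_
  have hρ' : Prepared M S w tips ρ' := hρ.frame hF' (by decide) (by decide)
  have h50' : ρ'.reg 50 = _ := (hF'.1 50 (by decide)).trans h50
  have h53' : ρ'.reg 53 = _ := (hF'.1 53 (by decide)).trans h53
  have h43' : ρ'.reg 43 = _ := ((hF'.1 43 (by decide)).trans (hF.1 43 (by decide))).trans hBL
  have h34' : ρ'.reg 34 = _ := ((hF'.1 34 (by decide)).trans (hF.1 34 (by decide))).trans hL
  have hlt₁ : (insertLabel z (d, e)).1 < 2 * N + 2 := by simp only [insertLabel]; omega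
  have hlt₂ : (insertLabel z (d, e)).2 < 2 * N + 2 := by simp only [insertLabel]; omega
  generalize insertLabel z (d, e) = q at *
  rw [wp_cond, h54]
  constructor
  · intro hb
    simp [hb, hρ'.codeCount, hρ'.zero]
    omega
  · intro hb
    simp only [wp_block_cons, wp_block_singleton, wp_const, hb, if_false]
    refine wp_addLoop q.1 (by simp [h50']) (by simp [hρ'.one]) (by decide) ?_
    intro ρ₁ t₁ hF₁ h49 ht₁
    refine wp_addLoop q.2 (by simp [hF₁.1 53 (by decide), h53'])
      (by simp [hF₁.1 0 (by decide), hρ'.one]) (by decide) ?_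
    intro ρ₂ t₂ hF₂ h49' ht₂
    refine ⟨by omega, ?_⟩
    rw [h49', h49, hF₁.1 34 (by decide)]
    simp [h43', h34']
    ring

theorem wp_fillBlock (h : Prepared M S w tips σ) {L off b : ℕ} (hL : σ.reg 34 = L)
    (hoff : σ.reg 45 = off) (hb : σ.reg 49 = b) :
    wp fillBlock σ fun τ t => t ≤ L * (4 + 2) + 2 ∧
      (∀ k < L, τ.arr 11 (off + k) = σ.arr 11 k + b) ∧
      ∀ i, (i < off ∨ off + L ≤ i) → τ.arr 11 i = σ.arr 11 i := by
  simp only [fillBlock, wp_block_cons, wp_block_singleton, wp_add, hL, h.zero, add_zero]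
  refine wp_forDown L 4
    (fun i ρ => (∀ k < L, i ≤ k → ρ.arr 11 (off + k) = σ.arr 11 k + b) ∧
      ∀ k, (k < off + i ∨ off + L ≤ k) → ρ.arr 11 k = σ.arr 11 k) (by simp) (by simp [h.one])
    (by decide) (by decide) ?_ ?_ ?_
  · exact ⟨fun k hk hk' => absurd hk (by omega), fun k _ => rfl⟩
  · rintro i hi ρ hF ⟨h₁, h₂⟩
    have h45 := hF.1 45 (by decide)
    have h49 := hF.1 49 (by decide)
    simp [hoff] at h45
    simp [hb] at h49
    have haddr : ((off : ℤ) + i).toNat = off + i := by omega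
    -- Even for `off = 0`, where old and new table coincide in place, cell `i` is read before it is
    -- overwritten.
    have hread := h₂ i (by omega)
    simp [h45, h49, haddr, hread]
    refine ⟨fun k hk hik => ?_, fun k hk => ?_⟩
    · split_ifs with hki
      · rw [hki]
      · exact h₁ k hk (by omega)
    · rw [if_neg (by omega)]
      exact h₂ k (by omega)
  · rintro τ t hF ⟨h₁, h₂⟩ ht
    exact ⟨by omega, fun k hk => h₁ k hk (Nat.zero_le _), fun i hi => h₂ i (by omega)⟩

end LeafageSFVS

/-! ### The program: the table of next codes -/

namespace LeafageSFVS

open RAMProg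

/-- Extend the table of next codes by one digit, that is, by one pair. -/
def extendTable : RAMProg := block [
  add 47 6 1,
  forDown 47 (block [
    add 48 6 1,
    forDown 48 (block [sub 45 45 34, computeDigit, fillBlock])])]

/-- Compute the table of next codes for the vertex in turn. -/
def computeNext : RAMProg := block [
  store 11 1 1, const 34 1,
  add 35 5 1,
  forDown 35 (block [
    computeLabel,
    const 43 0, add 44 6 1, addLoop 43 34 44,
    const 45 0, add 44 6 1, addLoop 45 43 44,
    add 46 45 1,
    extendTable,
    add 34 46 1])]

variable {n : ℕ} {G : SimpleGraph (Fin n)} {N : ℕ} {M : TreeModel G N} {S : Finset (Fin n)}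
  {w : Fin n → ℤ} {tips : List (Fin N)} {σ : RAMState}

/-- The entries from `off` on have their new values, and the old ones that are still needed are
still there. -/
def TableInv (K L : ℕ) (new old : ℕ → ℕ) (off : ℕ) (ρ : RAMState) : Prop :=
  ρ.reg 45 = off ∧ (∀ i < K, off ≤ i → ρ.arr 11 i = new i) ∧
    ∀ k < L, k < off → ρ.arr 11 k = old k

/-- The old table occupies the first `L` cells. Blocks are written from the top down, so the block
of digit `0`, which replaces the old table itself, comes last. The cost is linear in the size of the
new table, up to a term of order `B ^ 3`. -/
theorem wp_extendTable (h : Prepared M S w tips σ) {z m c L : ℕ} {old : ℕ → ℕ}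
    (hz : σ.reg 42 = z) (hm : σ.reg 32 = m) (hc : σ.reg 30 = c) (hL : σ.reg 34 = L)
    (hBL : σ.reg 43 = ((2 * N + 2) * L : ℕ))
    (hBBL : σ.reg 45 = ((2 * N + 2) * (2 * N + 2) * L : ℕ))
    (hzB : z < 2 * N + 2) (hold : ∀ k < L, σ.arr 11 k = old k) :
    wp extendTable σ fun τ t =>
      t ≤ (2 * N + 2) * ((2 * N + 2) * (6 * (2 * N + 2) + 6 * L + 23 + 2) + 2 + 2) + 2 ∧
      ∀ k < (2 * N + 2) * (2 * N + 2) * L, τ.arr 11 k =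
        (((if Blocked m c z (k / L / (2 * N + 2), k / L % (2 * N + 2)) then
            ((2 * N + 2) * (2 * N + 2)) ^ tips.length
          else insertCode (2 * N + 2) z (k / L) * L) + old (k % L) : ℕ) : ℤ) := by
  have hB := h.base
  have hzero := h.zero
  have hone := h.one
  generalize hBdef : 2 * N + 2 = B at *
  simp only [extendTable, wp_block_cons, wp_block_singleton, wp_add, hB, hzero, add_zero]
  set new : ℕ → ℕ := fun k => (if Blocked m c z (k / L / B, k / L % B) then
    (B * B) ^ tips.length else insertCode B z (k / L) * L) + old (k % L) with hnew
  refine wp_forDown B (B * (6 * B + 6 * L + 23 + 2) + 2)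
    (fun i ρ => TableInv (B * B * L) L new old (i * B * L) ρ) (by simp) (by simp [hone])
    (by decide) (by decide) ?_ ?_ ?_
  · exact ⟨by simp [hBBL], fun i hi hi' => absurd hi (by omega), fun k hk _ => by simp [hold k hk]⟩
  · rintro d hd ρ hF hI
    have hρ : Prepared M S w tips ρ := Prepared.frame (h.setReg (by decide) _) hF
      (by decide) (by decide)
    have hρB := hρ.base
    rw [hBdef] at hρB
    simp [hρB, hρ.zero]
    refine wp_forDown B (6 * B + 6 * L + 23)
      (fun j ρ => TableInv (B * B * L) L new old ((d * B + j) * L) ρ) (by simp) (by simp [hρ.one])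
      (by decide) (by decide) ?_ ?_ ?_
    · rw [show (d * B + B) * L = (d + 1) * B * L by ring]
      exact hI
    · rintro e he τ hF' ⟨hoff, h₁, h₂⟩
      have hτ : Prepared M S w tips τ := Prepared.frame
        ((hρ.setReg (by decide) _).setReg (by decide) _) hF' (by decide) (by decide)
      have get : ∀ r, r ∉ (forDown 47 (block [add 48 6 1,
          forDown 48 (block [sub 45 45 34, computeDigit, fillBlock])])).regs →
          r ∉ (forDown 48 (block [sub 45 45 34, computeDigit, fillBlock])).regs →
          r ≠ 47 → r ≠ 48 → τ.reg r = σ.reg r := by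
        intro r hr₁ hr₂ hr₃ hr₄
        rw [hF'.1 r hr₂]
        simp only [RAMState.setReg_reg, hr₃, hr₄, if_false]
        rw [hF.1 r hr₁]
        simp [hr₃]
      have h47 : τ.reg 47 = d := by
        rw [hF'.1 47 (by decide)]
        simp
      have hq : d * B + e < B * B := pair_code_lt hd he
      set q := d * B + e with hqdef
      have hoff' : τ.reg 45 - τ.reg 34 = (q * L : ℕ) := by
        rw [hoff, get 34 (by decide) (by decide) (by decide) (by decide), hL]
        push_cast [hqdef]
        ring
      simp only [wp_block_cons, wp_block_singleton, wp_sub, RAMState.setReg_reg]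
      simp only [show (45 : ℕ) ≠ 48 by decide, show (34 : ℕ) ≠ 48 by decide, if_false, hoff']
      have hτ' : Prepared M S w tips ((τ.setReg 48 e).setReg 45 (q * L : ℕ)) :=
        (hτ.setReg (by decide) _).setReg (by decide) _
      refine wp_mono (wp_computeDigit hτ' (d := d) (e := e) (z := z) (m := m) (c := c) (L := L)
        (by simp [h47]) (by simp)
        (by simp [get 42 (by decide) (by decide) (by decide) (by decide), hz])
        (by simp [get 32 (by decide) (by decide) (by decide) (by decide), hm])
        (by simp [get 30 (by decide) (by decide) (by decide) (by decide), hc])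
        (by simp [get 34 (by decide) (by decide) (by decide) (by decide), hL])
        (by simp [get 43 (by decide) (by decide) (by decide) (by decide), hBL, ← hBdef])
        (by omega) (by omega) (by omega)) fun ρ₁ t₁ hF₁ ⟨ht₁, h49⟩ => ?_
      have hρ₁ : Prepared M S w tips ρ₁ := hτ'.frame hF₁ (by decide) (by decide)
      refine wp_mono (wp_fillBlock hρ₁ (L := L) (off := q * L)
        (by rw [hF₁.1 34 (by decide)]
            simp [get 34 (by decide) (by decide) (by decide) (by decide), hL])
        (by rw [hF₁.1 45 (by decide)]; simp) h49) fun ρ₂ t₂ hF₂ ⟨ht₂, hfill, hkeep⟩ => ?_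
      have harr : ρ₁.arr 11 = τ.arr 11 := (hF₁.2 11 (by decide)).trans rfl
      rw [hBdef] at hfill ht₁
      simp only [harr] at hfill hkeep
      have hmul : (d * B + (e + 1)) * L = q * L + L := by
        rw [hqdef]
        ring
      rw [hmul] at h₁ h₂
      refine ⟨by omega, ?_, ?_, ?_⟩
      · rw [hF₂.1 45 (by decide), hF₁.1 45 (by decide)]
        simp
      · intro i hi hqi
        -- Within the current block, division by `L` recovers the digit `q` and the remainder is the
        -- old code.
        by_cases hi' : i < q * L + L
        · obtain ⟨k, rfl⟩ := Nat.exists_eq_add_of_le hqi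
          have hk : k < L := by omega
          have hdiv : (q * L + k) / L = q := pair_code_div hk
          have hmod : (q * L + k) % L = k := pair_code_mod hk
          rw [hfill k hk, h₂ k hk (by omega), hnew]
          simp only [hdiv, hmod, insertCode]
          rw [pair_code_div he, pair_code_mod he]
          push_cast
          ring
        · rw [hkeep i (.inr (by omega))]
          exact h₁ i hi (by omega)
      · intro k hk hkq
        rw [hkeep k (.inl hkq)]
        exact h₂ k hk (by omega)
    · intro τ t _ hI' ht
      refine ⟨by omega, ?_⟩
      simpa using hI'
  · rintro τ t - ⟨-, h₁, -⟩ ht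
    exact ⟨by omega, fun k hk => h₁ k hk (by simp)⟩

/-- The table starts with the single entry `0` for no tips and gains one tip per pass, from the end
of the list. Each pass produces at most `W` entries, which bounds its cost by `6 * W` plus a term of
order `B ^ 3`. -/
theorem wp_computeNext (h : Prepared M S w tips σ) {v : Fin n} (h22 : σ.reg 22 = (N * v : ℕ))
    (h30 : σ.reg 30 = if v ∈ S then 1 else 0) (h32 : σ.reg 32 = (2 * M.level v + 1 : ℕ)) :
    wp computeNext σ fun τ t =>
      t ≤ tips.length * (6 * ((2 * N + 2) * (2 * N + 2)) ^ tips.length + 80 * (2 * N + 2) ^ 3 + 2)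
        + 4 ∧
      ∀ k < ((2 * N + 2) * (2 * N + 2)) ^ tips.length, τ.arr 11 k = M.next S tips v k := by
  simp only [computeNext, wp_block_cons, wp_block_singleton, wp_add, wp_store, wp_const,
    RAMState.setReg_reg, RAMState.setArr_reg, h.zero, h.tipCount]
  set B := 2 * N + 2 with hB
  set r := tips.length with hr
  have hσ : Prepared M S w tips (((σ.setArr 11 (Int.toNat 0) 0).setReg 34 1).setReg 35 r) :=
    ((h.congr (by simp) (fun a ha _ => by
      funext i
      rw [RAMState.setArr_arr, if_neg (by omega)])).setReg (by decide) _).setReg (by decide) _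
  refine wp_forDown r (6 * (B * B) ^ r + 80 * B ^ 3)
    (fun j ρ => ρ.reg 34 = ((B * B) ^ (r - j) : ℕ) ∧
      ∀ k < (B * B) ^ (r - j), ρ.arr 11 k = nextCode B ((B * B) ^ r) (2 * M.level v + 1)
        (if v ∈ S then 1 else 0) (M.label S v) (tips.drop j) k) (by simp) (by simp [h.one])
    (by decide) (by decide) ?_ ?_ ?_
  · refine ⟨by simp, fun k hk => ?_⟩
    have : k = 0 := by simpa using hk
    subst this
    rw [hr, List.drop_length]
    simp [nextCode]
  · rintro j hj ρ hF ⟨h34, harr⟩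
    have hρ : Prepared M S w tips (ρ.setReg 35 j) := Prepared.setReg (Prepared.frame hσ (by
      simpa using hF) (by decide) (by decide)) (by decide) _
    have get : ∀ r', r' ∉ (forDown 35 (block [computeLabel,
        const 43 0, add 44 6 1, addLoop 43 34 44, const 45 0, add 44 6 1, addLoop 45 43 44,
        add 46 45 1, extendTable, add 34 46 1])).regs → r' ≠ 34 → r' ≠ 35 →
        (ρ.setReg 35 j).reg r' = σ.reg r' := by
      intro r' h₁ h₂ h₃
      simp only [RAMState.setReg_reg, h₃, if_false]
      rw [hF.1 r' h₁]
      simp [h₂, h₃]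
    set L := (B * B) ^ (r - (j + 1)) with hL
    have hLL : (B * B) ^ (r - j) = B * B * L := by
      rw [hL, ← pow_succ']
      congr 1
      omega
    have hLr : B * B * L ≤ (B * B) ^ r := by
      rw [← hLL]
      exact Nat.pow_le_pow_right (by positivity) (by omega)
    simp only [wp_block_cons, wp_block_singleton, wp_add, wp_const]
    refine wp_mono (wp_computeLabel hρ (v := v) (j := j)
      (by rw [get 22 (by decide) (by decide) (by decide), h22])
      (by rw [get 30 (by decide) (by decide) (by decide), h30]) hj (by simp))
      fun ρ₁ t₁ hF₁ ⟨ht₁, h42⟩ => ?_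
    have hρ₁ := hρ.frame hF₁ (by decide) (by decide)
    have h34₁ : ρ₁.reg 34 = L := by
      rw [hF₁.1 34 (by decide)]
      simpa using h34
    refine wp_addLoop B (by simp [hρ₁.base, hρ₁.zero, hB]) (by simp [hρ₁.one]) (by decide) ?_
    intro ρ₂ t₂ hF₂ h43 ht₂
    have hρ₂ : Prepared M S w tips ρ₂ := Prepared.frame
      ((hρ₁.setReg (by decide) _).setReg (by decide) _) hF₂ (by decide) (by decide)
    have h43₂ : ρ₂.reg 43 = (B * L : ℕ) := by
      rw [h43]
      simp [h34₁]
    refine wp_addLoop B (by simp [hρ₂.base, hρ₂.zero, hB]) (by simp [hρ₂.one]) (by decide) ?_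
    intro ρ₃ t₃ hF₃ h45 ht₃
    have hρ₃ : Prepared M S w tips ρ₃ := Prepared.frame
      ((hρ₂.setReg (by decide) _).setReg (by decide) _) hF₃ (by decide) (by decide)
    have h45₃ : ρ₃.reg 45 = (B * B * L : ℕ) := by
      rw [h45]
      simp [h43₂]
      ring
    have get₃ : ∀ r', r' ∉ computeLabel.regs → r' ≠ 43 → r' ≠ 44 → r' ≠ 45 →
        ρ₃.reg r' = (ρ.setReg 35 j).reg r' := by
      intro r' h₁ h₂ h₃ h₄
      rw [hF₃.1 r' (by simp [addLoop, forDown, regs, h₃, h₄])]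
      simp only [RAMState.setReg_reg, h₃, h₄, if_false]
      rw [hF₂.1 r' (by simp [addLoop, forDown, regs, h₂, h₃])]
      simp only [RAMState.setReg_reg, h₂, h₃, if_false]
      rw [hF₁.1 r' h₁]
      simp
    have harr₃ : ρ₃.arr 11 = ρ.arr 11 := by
      rw [hF₃.2 11 (by decide), RAMState.setReg_arr, RAMState.setReg_arr, hF₂.2 11 (by decide),
        RAMState.setReg_arr, RAMState.setReg_arr, hF₁.2 11 (by decide), RAMState.setReg_arr]
    have h42₃ : ρ₃.reg 42 = M.label S v tips[j] := by
      rw [hF₃.1 42 (by decide)]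
      simp only [RAMState.setReg_reg]
      rw [if_neg (by decide), if_neg (by decide), hF₂.1 42 (by decide)]
      simpa using h42
    have h43₃ : ρ₃.reg 43 = (B * L : ℕ) := by
      rw [hF₃.1 43 (by decide)]
      simpa using h43₂
    refine wp_mono (wp_extendTable (hρ₃.setReg (d := 46) (by decide) (ρ₃.reg 45 + ρ₃.reg 1))
      (z := M.label S v tips[j]) (m := 2 * M.level v + 1) (c := if v ∈ S then 1 else 0) (L := L)
      (old := nextCode B ((B * B) ^ r) (2 * M.level v + 1)
        (if v ∈ S then 1 else 0) (M.label S v) (tips.drop (j + 1)))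
      (by simpa using h42₃)
      (by rw [RAMState.setReg_reg, if_neg (by decide), get₃ 32 (by decide) (by decide) (by decide)
            (by decide), get 32 (by decide) (by decide) (by decide), h32])
      (by rw [RAMState.setReg_reg, if_neg (by decide), get₃ 30 (by decide) (by decide) (by decide)
            (by decide), get 30 (by decide) (by decide) (by decide), h30]
          simp)
      (by rw [RAMState.setReg_reg, if_neg (by decide), get₃ 34 (by decide) (by decide) (by decide)
            (by decide)]
          simpa using h34)
      (by simpa [hB] using h43₃) (by simpa [hB] using h45₃) (TreeModel.label_lt _ _)
      (by
        intro k hk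
        rw [RAMState.setReg_arr, harr₃]
        exact harr k hk)) fun ρ₄ t₄ hF₄ ⟨ht₄, htab⟩ => ?_
    rw [← hB] at ht₄ htab
    have h46 : ρ₄.reg 46 = (B * B * L : ℕ) := by
      rw [hF₄.1 46 (by decide)]
      simp only [RAMState.setReg_reg, if_true]
      rw [h45₃, hρ₃.zero, add_zero]
    have h1 : ρ₄.reg 1 = 0 := by
      rw [hF₄.1 1 (by decide)]
      simpa using hρ₃.zero
    refine ⟨?_, ?_, ?_⟩
    · clear * - ht₁ ht₂ ht₃ ht₄ hLr hB
      have hB2 : 2 ≤ B := by omega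
      have hNB : 2 * N ≤ B := by omega
      have e₁ : B * (B * (6 * B + 6 * L + 23 + 2) + 2 + 2) + 2
          = 6 * B ^ 3 + 6 * (B * B * L) + 25 * B ^ 2 + 4 * B + 2 := by ring
      have e₂ : 2 * B ^ 2 ≤ B ^ 3 := by
        rw [pow_succ' B 2]
        exact Nat.mul_le_mul_right _ hB2
      have e₃ : 2 * B ≤ B ^ 2 := by
        rw [pow_two]
        exact Nat.mul_le_mul_right _ hB2
      rw [e₁] at ht₄
      omega
    · rw [RAMState.setReg_reg, if_pos rfl, h46, h1, hLL, add_zero]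
    · intro k hk
      rw [hLL] at hk
      rw [RAMState.setReg_arr, htab k hk, List.drop_eq_getElem_cons hj, nextCode]
      have hlen : (tips.drop (j + 1)).length = r - (j + 1) := by simp [hr]
      rw [hlen]
  · rintro τ t - ⟨-, harr⟩ ht
    refine ⟨by omega, fun k hk => ?_⟩
    rw [harr k (by simpa using hk)]
    rfl

end LeafageSFVS

/-! ### The program: the layers of the dynamic program -/

namespace LeafageSFVS

open RAMProg

/-- Compute the next layer of the dynamic program: the best values (array `12`), the codes to go on
with (array `13`) and the decisions (array `14`). Register `10` holds the offset of the layer, and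
the vertex of the layer is stored in array `15`. -/
def updateLayer : RAMProg := block [
  add 60 10 8, add 61 8 1,
  forDown 61 (block [
    add 62 10 61, load 63 12 62, load 64 11 61, add 65 60 61,
    store 12 65 63, store 13 65 61, store 14 65 0,
    sub 66 8 64,
    .cond 66 (block [
      add 67 10 64, load 67 12 67, add 67 67 31, sub 68 67 63,
      .cond 68 (block [store 12 65 67, store 13 65 64, store 14 65 1]) skip]) skip]),
  add 10 60 1, store 15 9 21, add 9 9 0]

/-- Process the vertex in register `21`, whose level is in register `20`. -/
def processVertex : RAMProg := block [
  load 30 2 21, load 31 3 21, add 32 20 20, add 32 32 0,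
  computeNext, updateLayer]

/-- Process all vertices in the order of decreasing levels. -/
def mainLoop : RAMProg := block [
  add 20 3 1,
  forDown 20 (block [
    add 21 2 1,
    forDown 21 (block [
      computeLevel,
      sub 26 24 20,
      .cond 26 skip (block [sub 26 20 24, .cond 26 skip processVertex])])])]

/-- Follow the decisions and write the solution. -/
def writeOutput : RAMProg := block [
  const 69 0, add 20 2 1,
  forDown 20 (block [
    load 21 15 20, add 22 10 69, load 23 14 22, store 6 21 23, load 69 13 22, sub 10 10 8])]

/-- The whole program. -/
def program : RAMProg := block [prepare, mainLoop, writeOutput]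

section Layers

variable {n : ℕ} (W : ℕ) (next : Fin n → ℕ → ℕ) (w : Fin n → ℤ)

/-- The decisions of the dynamic program for the list `l` of vertices are stored. -/
def TraceOK : List (Fin n) → RAMState → Prop
  | [], _ => True
  | v :: l, ρ => ρ.arr 15 l.length = (v : ℕ) ∧
      (∀ k < W, ρ.arr 13 ((l.length + 1) * W + k) =
          ((if Takes W next w v l k then next v k else k : ℕ) : ℤ) ∧
        ρ.arr 14 ((l.length + 1) * W + k) = if Takes W next w v l k then 0 else 1) ∧
      TraceOK l ρ

/-- The layers of the dynamic program up to the one for the list `l` are stored. -/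
structure LayerInv (l : List (Fin n)) (ρ : RAMState) : Prop where
  count : ρ.reg 9 = l.length
  offset : ρ.reg 10 = (l.length * W : ℕ)
  best : ∀ k < W, ρ.arr 12 (l.length * W + k) = bestValue W next w l k
  trace : TraceOK W next w l ρ

variable {W next w}

theorem TraceOK.congr {l : List (Fin n)} {ρ τ : RAMState} (h : TraceOK W next w l ρ)
    (h13 : ∀ i < (l.length + 1) * W, τ.arr 13 i = ρ.arr 13 i)
    (h14 : ∀ i < (l.length + 1) * W, τ.arr 14 i = ρ.arr 14 i)
    (h15 : ∀ i < l.length, τ.arr 15 i = ρ.arr 15 i) : TraceOK W next w l τ := by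
  induction l with
  | nil => trivial
  | cons v l ih =>
    obtain ⟨h₁, h₂, h₃⟩ := h
    have hlen : (v :: l).length = l.length + 1 := rfl
    rw [hlen] at h13 h14 h15
    have hW : (l.length + 1 + 1) * W = (l.length + 1) * W + W := by ring
    refine ⟨by rw [h15 _ (by omega), h₁], fun k hk => ?_, ih h₃ (fun i hi => h13 i (by omega))
      (fun i hi => h14 i (by omega)) (fun i hi => h15 i (by omega))⟩
    rw [h13 _ (by omega), h14 _ (by omega)]
    exact h₂ k hk

theorem LayerInv.congr {l : List (Fin n)} {ρ τ : RAMState} (h : LayerInv W next w l ρ)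
    (h9 : τ.reg 9 = ρ.reg 9) (h10 : τ.reg 10 = ρ.reg 10)
    (ha : ∀ a, 12 ≤ a → a < 16 → τ.arr a = ρ.arr a) : LayerInv W next w l τ where
  count := h9.trans h.count
  offset := h10.trans h.offset
  best := by rw [ha 12 (by decide) (by decide)]; exact h.best
  trace := h.trace.congr (fun i _ => by rw [ha 13 (by decide) (by decide)])
    (fun i _ => by rw [ha 14 (by decide) (by decide)])
    (fun i _ => by rw [ha 15 (by decide) (by decide)])

theorem LayerInv.frame {l : List (Fin n)} {p : RAMProg} {ρ τ : RAMState}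
    (h : LayerInv W next w l ρ) (hF : Frame p ρ τ) (h9 : 9 ∉ p.regs) (h10 : 10 ∉ p.regs)
    (ha : ∀ a < 16, 12 ≤ a → a ∉ p.arrs) : LayerInv W next w l τ :=
  h.congr (hF.1 9 h9) (hF.1 10 h10) fun a h₁ h₂ => hF.2 a (ha a h₂ h₁)

theorem wp_updateLayer {σ : RAMState} {l : List (Fin n)} {v : Fin n}
    (h : LayerInv W next w l σ) (hone : σ.reg 0 = 1) (hzero : σ.reg 1 = 0) (hW : σ.reg 8 = W)
    (hv : σ.reg 21 = (v : ℕ)) (hw : σ.reg 31 = w v)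
    (hnext : ∀ k < W, σ.arr 11 k = next v k) :
    wp updateLayer σ fun τ t => t ≤ W * (17 + 2) + 6 ∧ LayerInv W next w (v :: l) τ := by
  simp only [updateLayer, wp_block_cons, wp_block_singleton, wp_add, wp_store,
    RAMState.setReg_reg, RAMState.setArr_reg, hW, hzero, h.offset]
  have hlen : (l.length + 1) * W = l.length * W + W := by ring
  refine wp_forDown W 17
    (fun i ρ => (∀ k < l.length * W + W, ρ.arr 12 k = σ.arr 12 k) ∧
      (∀ k < l.length * W + W, ρ.arr 13 k = σ.arr 13 k) ∧
      (∀ k < l.length * W + W, ρ.arr 14 k = σ.arr 14 k) ∧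
      ∀ k < W, i ≤ k → ρ.arr 12 (l.length * W + W + k) = bestValue W next w (v :: l) k ∧
        ρ.arr 13 (l.length * W + W + k) =
          ((if Takes W next w v l k then next v k else k : ℕ) : ℤ) ∧
        ρ.arr 14 (l.length * W + W + k) = if Takes W next w v l k then 0 else 1)
    (by simp) (by simp [hone]) (by decide) (by decide) ?_ ?_ ?_
  · exact ⟨fun _ _ => rfl, fun _ _ => rfl, fun _ _ => rfl, fun k hk hk' => absurd hk (by omega)⟩
  · rintro i hi ρ hF ⟨h12, h13, h14, hnew⟩
    have get : ∀ r, r ∉ (forDown 61 (block [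
        add 62 10 61, load 63 12 62, load 64 11 61, add 65 60 61,
        store 12 65 63, store 13 65 61, store 14 65 0, sub 66 8 64,
        .cond 66 (block [
          add 67 10 64, load 67 12 67, add 67 67 31, sub 68 67 63,
          .cond 68 (block [store 12 65 67, store 13 65 64, store 14 65 1]) skip]) skip])).regs →
        r ≠ 60 → r ≠ 61 → ρ.reg r = σ.reg r := by
      intro r h₁ h₂ h₃
      rw [hF.1 r h₁]
      simp [h₂, h₃]
    have r0 := (get 0 (by decide) (by decide) (by decide)).trans hone
    have r1 := (get 1 (by decide) (by decide) (by decide)).trans hzero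
    have r8 := (get 8 (by decide) (by decide) (by decide)).trans hW
    have r10 := (get 10 (by decide) (by decide) (by decide)).trans h.offset
    have r31 := (get 31 (by decide) (by decide) (by decide)).trans hw
    have r60 : ρ.reg 60 = (l.length * W : ℕ) + W := by
      rw [hF.1 60 (by decide)]
      simp
    have a11 : ρ.arr 11 i = next v i := by
      rw [hF.2 11 (by decide)]
      exact hnext i hi
    have a12 : ρ.arr 12 (l.length * W + i) = bestValue W next w l i := by
      rw [h12 _ (by omega), h.best i hi]
    -- Only a valid successor indexes a cell of the previous layer.
    have a12' : next v i < W →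
        ρ.arr 12 (l.length * W + next v i) = bestValue W next w l (next v i) := by
      intro hlt
      rw [h12 _ (by omega), h.best _ hlt]
    generalize hoff : l.length * W = off at *
    have addr₁ : ((off : ℤ) + i).toNat = off + i := by omega
    have addr₂ : ((off : ℤ) + W + i).toNat = off + W + i := by omega
    have addr₃ : ((off : ℤ) + next v i).toNat = off + next v i := by omega
    -- The loop first records the decision to omit `v`. This record stands both when the successor
    -- is invalid and when choosing `v` brings no gain.
    have skip : ¬ Takes W next w v l i →
        (∀ k < off + W, (if k = off + W + i then bestValue W next w l i else ρ.arr 12 k) =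
          σ.arr 12 k) ∧
        (∀ k < off + W, (if k = off + W + i then (i : ℤ) else ρ.arr 13 k) = σ.arr 13 k) ∧
        (∀ k < off + W, (if k = off + W + i then 1 else ρ.arr 14 k) = σ.arr 14 k) ∧
        ∀ k < W, i ≤ k →
          (if k = i then bestValue W next w l i else ρ.arr 12 (off + W + k)) =
            bestValue W next w (v :: l) k ∧
          ((if k = i then (i : ℤ) else ρ.arr 13 (off + W + k)) =
            if Takes W next w v l k then (next v k : ℤ) else (k : ℤ)) ∧
          (if k = i then 1 else ρ.arr 14 (off + W + k)) =
            if Takes W next w v l k then 0 else 1 := by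
      intro htake
      have hbest : bestValue W next w (v :: l) i = bestValue W next w l i := if_neg htake
      refine ⟨fun k hk => ?_, fun k hk => ?_, fun k hk => ?_, fun k hk hik => ?_⟩
      · rw [if_neg (by omega), h12 k hk]
      · rw [if_neg (by omega), h13 k hk]
      · rw [if_neg (by omega), h14 k hk]
      · by_cases hki : k = i
        · subst hki
          simp [htake, hbest]
        · simpa [hki] using hnew k hk (by omega)
    simp [r0, r1, r8, r10, r31, r60, a11, a12, addr₁, addr₂, addr₃]
    refine ⟨fun hlt => ?_, fun hge => ?_⟩
    -- The store just made lies in the new layer, so it does not affect the value read for the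
    -- successor.
    · rw [if_neg (by omega : ¬ off + next v i = off + W + i), a12' hlt]
      refine ⟨fun hgt => ?_, fun hle => ?_⟩
      · have htake : Takes W next w v l i := ⟨hlt, by omega⟩
        have hbest : bestValue W next w (v :: l) i = w v + bestValue W next w l (next v i) :=
          if_pos htake
        refine ⟨fun k hk => ?_, fun k hk => ?_, fun k hk => ?_, fun k hk hik => ?_⟩
        · rw [if_neg (by omega), if_neg (by omega), h12 k hk]
        · rw [if_neg (by omega), if_neg (by omega), h13 k hk]
        · rw [if_neg (by omega), if_neg (by omega), h14 k hk]
        · by_cases hki : k = i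
          · subst hki
            simp [htake, hbest, add_comm]
          · simpa [hki] using hnew k hk (by omega)
      · exact skip fun htake => by
          have := htake.2
          omega
    · exact skip fun htake => by
        have := htake.1
        omega
  · rintro τ t hF ⟨h12, h13, h14, hnew⟩ ht
    have r60 : τ.reg 60 = (l.length * W + W : ℕ) := by
      rw [hF.1 60 (by decide)]
      simp
    have r1 : τ.reg 1 = 0 := by
      rw [hF.1 1 (by decide)]
      simp [hzero]
    have r0 : τ.reg 0 = 1 := by
      rw [hF.1 0 (by decide)]
      simp [hone]
    have r9 : τ.reg 9 = l.length := by
      rw [hF.1 9 (by decide)]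
      simp [h.count]
    have r21 : τ.reg 21 = (v : ℕ) := by
      rw [hF.1 21 (by decide)]
      simp [hv]
    refine ⟨by omega, ?_, ?_, ?_, ?_⟩
    · simp [r0, r9]
    · simp [r60, r1]
      ring
    · intro k hk
      simp [hlen]
      exact (hnew k hk (Nat.zero_le _)).1
    · refine ⟨by simp [r9, r21], fun k hk => ?_, ?_⟩
      · rw [hlen]
        simpa using (hnew k hk (Nat.zero_le _)).2
      · refine h.trace.congr (fun i hi => ?_) (fun i hi => ?_) (fun i hi => ?_)
        · simp [h13 i (by omega)]
        · simp [h14 i (by omega)]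
        · have h15 := hF.2 15 (by decide)
          simp [r9, hi.ne, h15]

end Layers

variable {n : ℕ} {G : SimpleGraph (Fin n)} {N : ℕ} {M : TreeModel G N} {S : Finset (Fin n)}
  {w : Fin n → ℤ} {tips : List (Fin N)} {σ : RAMState}

theorem wp_processVertex (h : Prepared M S w tips σ) {l : List (Fin n)} {v : Fin n}
    (hl : LayerInv (((2 * N + 2) * (2 * N + 2)) ^ tips.length) (M.next S tips) w l σ)
    (hv : σ.reg 21 = (v : ℕ)) (h22 : σ.reg 22 = (N * v : ℕ)) (h20 : σ.reg 20 = M.level v) :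
    wp processVertex σ fun τ t =>
      t ≤ 4 + (tips.length * (6 * ((2 * N + 2) * (2 * N + 2)) ^ tips.length +
        80 * (2 * N + 2) ^ 3 + 2) + 4) +
        (((2 * N + 2) * (2 * N + 2)) ^ tips.length * (17 + 2) + 6) ∧
      LayerInv (((2 * N + 2) * (2 * N + 2)) ^ tips.length) (M.next S tips) w (v :: l) τ := by
  simp [processVertex, hv, h20, h.one, h.terminal, h.weight]
  refine wp_mono (wp_computeNext (v := v) ((((h.setReg (d := 30) (by decide) _).setReg
    (d := 31) (by decide) _).setReg (d := 32) (by decide) _).setReg (d := 32) (by decide) _)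
    (by simp [h22]) (by simp) (by simp; ring)) fun ρ t hF ⟨ht, hnext⟩ => ?_
  have hρ : Prepared M S w tips ρ := Prepared.frame ((((h.setReg (d := 30) (by decide) _).setReg
    (d := 31) (by decide) _).setReg (d := 32) (by decide) _).setReg (d := 32) (by decide) _) hF
    (by decide) (by decide)
  have hlρ : LayerInv (((2 * N + 2) * (2 * N + 2)) ^ tips.length) (M.next S tips) w l ρ :=
    LayerInv.frame (ρ := (((σ.setReg 30 _).setReg 31 _).setReg 32 _).setReg 32 _)
      (hl.congr (by simp) (by simp) (fun _ _ _ => rfl)) hF (by decide) (by decide) (by decide)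
  refine wp_mono (wp_updateLayer (v := v) hlρ hρ.one hρ.zero hρ.codeCount
    (by rw [hF.1 21 (by decide)]; simp [hv]) (by rw [hF.1 31 (by decide)]; simp) hnext)
    fun τ t' _ ⟨ht', hτ⟩ => ⟨by omega, hτ⟩

end LeafageSFVS

/-! ### The program: correctness and running time -/

namespace LeafageSFVS

open RAMProg

variable {n : ℕ} {G : SimpleGraph (Fin n)} {N : ℕ} {M : TreeModel G N} {S : Finset (Fin n)}
  {w : Fin n → ℤ} {tips : List (Fin N)} {σ : RAMState}

/-- Prepending vertices by decreasing level keeps the list sorted by increasing level. The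
elapsed-time rule is essential: the inner body runs `N * n` times, but the large cost `P` arises
once per vertex and is charged to the length of `l`. -/
theorem wp_mainLoop (h : Prepared M S w tips σ) (h9 : σ.reg 9 = 0) (h10 : σ.reg 10 = 0)
    (h12 : ∀ i, σ.arr 12 i = 0) {W P : ℕ}
    (hW : W = ((2 * N + 2) * (2 * N + 2)) ^ tips.length)
    (hP : P = tips.length * (6 * W + 80 * (2 * N + 2) ^ 3 + 2) + 19 * W + 14) :
    wp mainLoop σ fun τ t =>
      ∃ l : List (Fin n), l.Nodup ∧ l.Pairwise (fun a b => M.level a ≤ M.level b) ∧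
        (∀ u, u ∈ l) ∧ LayerInv W (M.next S tips) w l τ ∧
        t ≤ l.length * P + N * (n * (3 * n + 9 * N + 20) + 4) + 2 := by
  simp only [mainLoop, wp_block_cons, wp_block_singleton, wp_add, h.nodes, h.zero, add_zero]
  generalize hc : 3 * n + 9 * N + 20 = c at *
  refine wp_forDown_elapsed N (fun i ρ s => ∃ l : List (Fin n), l.Nodup ∧
      l.Pairwise (fun a b => M.level a ≤ M.level b) ∧ (∀ u, u ∈ l ↔ i ≤ M.level u) ∧
      LayerInv W (M.next S tips) w l ρ ∧ s ≤ l.length * P + (N - i) * (n * c + 4))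
    (by simp) (by simp [h.one]) (by decide) (by decide) ?_ ?_ ?_
  · refine ⟨[], by simp, by simp, fun u => ?_, ⟨by simp [h9], by simp [h10],
      by simp [h12, bestValue], trivial⟩, by simp⟩
    obtain ⟨t, -, htd⟩ := (M.isSubtree u).exists_isRootOf
    have h₁ := M.host.depth_lt t
    have h₂ : M.level u < N := by rwa [htd] at h₁
    simp [h₂]
  · rintro i hi ρ s₀ hF ⟨l₀, hnd₀, hpw₀, hmem₀, hlay₀, hs₀⟩
    have hρ : Prepared M S w tips (ρ.setReg 20 i) := Prepared.setReg
      (Prepared.frame (h.setReg (by decide) _) hF (by decide) (by decide)) (by decide) _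
    simp only [wp_block_cons, wp_block_singleton, wp_add, hρ.size, hρ.zero, add_zero]
    refine wp_forDown_elapsed n (fun j τ s => ∃ l : List (Fin n), l.Nodup ∧
        l.Pairwise (fun a b => M.level a ≤ M.level b) ∧
        (∀ u, u ∈ l ↔ i < M.level u ∨ M.level u = i ∧ j ≤ u) ∧
        LayerInv W (M.next S tips) w l τ ∧
        s₀ + s ≤ l.length * P + (N - (i + 1)) * (n * c + 4) + (n - j) * c)
      (by simp) (by rw [RAMState.setReg_reg, if_neg (by decide), hρ.one]) (by decide) (by decide)
      ?_ ?_ ?_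
    · refine ⟨l₀, hnd₀, hpw₀, fun u => ?_, hlay₀.congr (by simp) (by simp) (fun _ _ _ => rfl),
        by simpa using hs₀⟩
      rw [hmem₀]
      have := u.2
      omega
    · rintro j hj τ s hF' ⟨l, hnd, hpw, hmem, hlay, hs⟩
      have hτ : Prepared M S w tips (τ.setReg 21 j) := Prepared.setReg
        (Prepared.frame (hρ.setReg (by decide) _) hF' (by decide) (by decide)) (by decide) _
      have h20 : (τ.setReg 21 j).reg 20 = i := by
        rw [RAMState.setReg_reg, if_neg (by decide), hF'.1 20 (by decide)]
        simp
      have hlay' : LayerInv W (M.next S tips) w l (τ.setReg 21 j) :=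
        hlay.congr (by simp) (by simp) (fun _ _ _ => rfl)
      generalize hvdef : (⟨j, hj⟩ : Fin n) = v at *
      have hjv : (v : ℕ) = j := by rw [← hvdef]
      simp only [wp_block_cons, wp_block_singleton]
      refine wp_mono (wp_computeLevel hτ (v := v) (by simp [hjv])) fun ρ₁ t₁ hF₁ ⟨ht₁, h22, h24⟩ =>
        ?_
      have hρ₁ := hτ.frame hF₁ (by decide) (by decide)
      have hlay₁ : LayerInv W (M.next S tips) w l ρ₁ := hlay'.frame hF₁ (by decide) (by decide)
        (by decide)
      have h20₁ : ρ₁.reg 20 = i := by rw [hF₁.1 20 (by decide), h20]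
      have h21₁ : ρ₁.reg 21 = (v : ℕ) := by
        rw [hF₁.1 21 (by decide)]
        simp [hjv]
      have hnj : (n - j) * c = (n - (j + 1)) * c + c := by
        rw [show n - j = n - (j + 1) + 1 by omega]
        ring
      -- A vertex of another level is skipped, and the description of the processed set does not
      -- change.
      have hne : M.level v ≠ i → ∀ u, u ∈ l ↔ i < M.level u ∨ M.level u = i ∧ j ≤ u := by
        intro hvi u
        rw [hmem]
        have : M.level u = i → (u : ℕ) ≠ j := by
          intro hu huj
          exact hvi (by rw [← hu, Fin.ext (huj.trans hjv.symm)])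
        omega
      simp only [wp_sub, wp_cond, wp_skip, wp_block_cons, wp_block_singleton, RAMState.setReg_reg,
        if_true, h24, h20₁, show (20 : ℕ) ≠ 26 by decide, show (24 : ℕ) ≠ 26 by decide, if_false]
      refine ⟨fun hlt => ?_, fun hge => ⟨fun hlt => ?_, fun hge' => ?_⟩⟩
      · exact ⟨l, hnd, hpw, hne (by omega), hlay₁.congr (by simp) (by simp) (fun _ _ _ => rfl),
          by omega⟩
      · exact ⟨l, hnd, hpw, hne (by omega), hlay₁.congr (by simp) (by simp) (fun _ _ _ => rfl),
          by omega⟩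
      · have hvi : M.level v = i := by omega
        have hlay₂ : LayerInv W (M.next S tips) w l
            ((ρ₁.setReg 26 ((M.level v : ℤ) - i)).setReg 26 ((i : ℤ) - M.level v)) :=
          hlay₁.congr (by simp) (by simp) (fun _ _ _ => rfl)
        rw [hW] at hlay₂
        refine wp_mono (wp_processVertex ((hρ₁.setReg (by decide) _).setReg (by decide) _) hlay₂
          (v := v) (by simp [h21₁]) (by simp [h22]) (by simp [h20₁, hvi]))
          fun τ₁ t₂ hF₂ ⟨ht₂, hlay₃⟩ => ?_
        rw [← hW] at hlay₃ ht₂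
        refine ⟨v :: l, List.nodup_cons.2 ⟨?_, hnd⟩, List.pairwise_cons.2 ⟨?_, hpw⟩, ?_, hlay₃, ?_⟩
        · rw [hmem]
          omega
        · intro u hu
          have := (hmem u).1 hu
          omega
        · intro u
          rw [List.mem_cons, hmem, Fin.ext_iff]
          constructor
          · rintro (hu | hu)
            · have : u = v := Fin.ext hu
              rw [this]
              omega
            · omega
          · rintro (hu | hu)
            · omega
            · omega
        · rw [List.length_cons, Nat.succ_mul]
          omega
    · rintro τ s hF' ⟨l, hnd, hpw, hmem, hlay, hs⟩
      refine ⟨l, hnd, hpw, fun u => ?_, hlay, ?_⟩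
      · rw [hmem]
        omega
      · rw [show N - i = N - (i + 1) + 1 by omega, Nat.succ_mul]
        simp only [Nat.sub_zero] at hs
        omega
  · rintro τ t hF ⟨l, hnd, hpw, hmem, hlay, ht⟩
    simp only [Nat.sub_zero] at ht
    exact ⟨l, hnd, hpw, fun u => (hmem u).2 (Nat.zero_le _), hlay, by omega⟩

theorem length_eq_of_nodup {l : List (Fin n)} (hnd : l.Nodup) (hl : ∀ u, u ∈ l) :
    l.length = n := by
  rw [← List.toFinset_card_of_nodup hnd, show l.toFinset = Finset.univ by ext; simp [hl],
    Finset.card_univ, Fintype.card_fin]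

/-- The layers are traversed from the full list down, following the stored codes from the initial
code `0`. On the vertices still to be visited, the overall choice agrees with the choice from the
current code. Decisions are stored as `1` for omitted vertices, so they are directly the indicator
of the solution. -/
theorem wp_writeOutput {W : ℕ} {next : Fin n → ℕ → ℕ} {l : List (Fin n)} (hW : 0 < W)
    (h0 : σ.reg 0 = 1) (h1 : σ.reg 1 = 0) (h2 : σ.reg 2 = n) (h8 : σ.reg 8 = W) (hnd : l.Nodup)
    (hl : ∀ u, u ∈ l) (h : LayerInv W next w l σ) :
    wp writeOutput σ fun τ t => t ≤ n * (6 + 2) + 3 ∧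
      Outputs τ (chosenSet W next w l 0)ᶜ := by
  have hlen := length_eq_of_nodup hnd hl
  simp only [writeOutput, wp_block_cons, wp_block_singleton, wp_add, wp_const,
    RAMState.setReg_reg, h1, h2]
  refine wp_forDown n 6
    (fun i ρ => ∃ (l' : List (Fin n)) (k : ℕ), l'.Nodup ∧ l'.length = i ∧ k < W ∧ ρ.reg 69 = k ∧
      ρ.reg 10 = (i * W : ℕ) ∧ TraceOK W next w l' σ ∧
      (∀ u ∈ l', u ∈ chosenSet W next w l 0 ↔ u ∈ chosenSet W next w l' k) ∧
      ∀ u ∉ l', ρ.arr 6 (u : ℕ) = if u ∈ chosenSet W next w l 0 then 0 else 1)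
    (by simp) (by simp [h0]) (by decide) (by decide) ?_ ?_ ?_
  · exact ⟨l, 0, hnd, hlen, hW, by simp, by simp [h.offset, hlen], h.trace, fun u _ => Iff.rfl,
      fun u hu => absurd (hl u) hu⟩
  · rintro i hi ρ hF ⟨l', k, hnd', hlen', hk, h69, h10, htr, hch, hout⟩
    cases l' with
    | nil => simp at hlen'
    | cons v l' =>
      rw [List.nodup_cons] at hnd'
      have hi' : l'.length = i := by simpa using hlen'
      obtain ⟨h15, hdec, htr'⟩ := htr
      rw [hi'] at h15 hdec
      obtain ⟨h13, h14⟩ := hdec k hk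
      have r8 : ρ.reg 8 = W := by
        rw [hF.1 8 (by decide)]
        simp [h8]
      have a13 : ρ.arr 13 = σ.arr 13 := hF.2 13 (by decide)
      have a14 : ρ.arr 14 = σ.arr 14 := hF.2 14 (by decide)
      have a15 : ρ.arr 15 = σ.arr 15 := hF.2 15 (by decide)
      have haddr : (((i : ℤ) + 1) * W + k).toNat = (i + 1) * W + k := by
        rw [← Nat.cast_succ, ← Nat.cast_mul, ← Nat.cast_add, Int.toNat_natCast]
      simp [h69, h10, r8, a13, a14, a15, h15, h13, h14, haddr]
      by_cases ht : Takes W next w v l' k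
      · have hchosen : chosenSet W next w (v :: l') k = insert v (chosenSet W next w l' (next v k)) :=
          if_pos ht
        rw [hchosen] at hch
        refine ⟨l', hnd'.2, hi', next v k, ht.1, by simp [ht], by ring, htr', fun u hu => ?_,
          fun u hu => ?_⟩
        · rw [hch u (by simp [hu]), Finset.mem_insert,
            or_iff_right (show u ≠ v from fun huv => hnd'.1 (huv ▸ hu))]
        · simp only [← Fin.ext_iff]
          split_ifs with huv hc hc
          · rfl
          · exact absurd ((hch v (by simp)).2 (Finset.mem_insert_self _ _)) (huv ▸ hc)
          · rw [hout u (by simp [hu, huv]), if_pos hc]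
          · rw [hout u (by simp [hu, huv]), if_neg hc]
      · have hchosen : chosenSet W next w (v :: l') k = chosenSet W next w l' k := if_neg ht
        rw [hchosen] at hch
        refine ⟨l', hnd'.2, hi', k, hk, by simp [ht], by ring, htr', fun u hu => ?_,
          fun u hu => ?_⟩
        · exact hch u (by simp [hu])
        · simp only [← Fin.ext_iff]
          split_ifs with huv hc hc
          · have := (hch v (by simp)).1 (huv ▸ hc)
            exact absurd (List.mem_toFinset.1 (chosenSet_subset W next w _ _ this)) hnd'.1
          · rfl
          · rw [hout u (by simp [hu, huv]), if_pos hc]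
          · rw [hout u (by simp [hu, huv]), if_neg hc]
  · rintro τ t hF ⟨l', k, hnd', hlen', hk, h69, h10, htr, hch, hout⟩ ht
    refine ⟨by omega, fun v => ?_⟩
    rw [List.length_eq_zero_iff] at hlen'
    rw [hout v (by simp [hlen'])]
    simp

/-- Everything is measured by `b = (2 * K + 2) * n`, which dominates `n` and `2 * N + 2`. Then `W`
is at most `E = b ^ (2 * ℓ)`, and `ℓ ≥ 2` gives `b ^ 3 ≤ E`, which absorbs the preparations, the
level scans and the overhead of the tables. -/
theorem time_le {n N K ℓ r : ℕ} (hℓ : 2 ≤ ℓ) (hn : 1 ≤ n) (hN : N ≤ K * n) (hr : r ≤ ℓ) {W P : ℕ}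
    (hW : W = ((2 * N + 2) * (2 * N + 2)) ^ r)
    (hP : P = r * (6 * W + 80 * (2 * N + 2) ^ 3 + 2) + 19 * W + 14) :
    100 * (r + 1) * (N + 1) ^ 2 + (n * P + N * (n * (3 * n + 9 * N + 20) + 4) + 2) +
      (n * (6 + 2) + 3) ≤ 1000 * (ℓ + 1) * (2 * K + 2) ^ (2 * ℓ + 1) * n ^ (2 * ℓ + 1) := by
  obtain ⟨b, hb⟩ : ∃ b, b = (2 * K + 2) * n := ⟨_, rfl⟩
  have hBb : 2 * N + 2 ≤ b := by rw [hb]; nlinarith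
  have hnb : n ≤ b := by rw [hb]; nlinarith
  have hb1 : 1 ≤ b := hn.trans hnb
  rw [mul_assoc (1000 * (ℓ + 1)), ← mul_pow, ← hb, pow_succ b (2 * ℓ)]
  have hWE : W ≤ b ^ (2 * ℓ) := by
    rw [hW, ← pow_two, ← pow_mul]
    exact (Nat.pow_le_pow_left hBb _).trans (Nat.pow_le_pow_right hb1 (by omega))
  have hpow : ∀ m ≤ 4, b ^ m ≤ b ^ (2 * ℓ) := fun m hm => Nat.pow_le_pow_right hb1 (by omega)
  generalize b ^ (2 * ℓ) = E at *
  have hE1 : 1 ≤ E := hpow 0 (by omega)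
  have hE2 : b ^ 2 ≤ E := hpow 2 (by omega)
  have hE3 : b ^ 3 ≤ E := hpow 3 (by omega)
  have hEb : E ≤ E * b := Nat.le_mul_of_pos_right _ hb1
  have hP' : P ≤ (100 * (ℓ + 1)) * E := by
    have h₁ : (2 * N + 2) ^ 3 ≤ E := (Nat.pow_le_pow_left hBb 3).trans hE3
    have h₂ : r * (6 * W + 80 * (2 * N + 2) ^ 3 + 2) ≤ ℓ * (88 * E) :=
      Nat.mul_le_mul hr (by omega)
    rw [hP]
    calc _ ≤ ℓ * (88 * E) + 19 * E + 14 * E := by omega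
      _ ≤ _ := by nlinarith
  have h₁ : n * P ≤ 100 * (ℓ + 1) * (E * b) :=
    calc n * P ≤ b * (100 * (ℓ + 1) * E) := Nat.mul_le_mul hnb hP'
      _ = _ := by ring
  have h₂ : 100 * (r + 1) * (N + 1) ^ 2 ≤ 100 * (ℓ + 1) * (E * b) := by
    refine Nat.mul_le_mul (Nat.mul_le_mul_left _ (by omega)) ?_
    exact ((Nat.pow_le_pow_left (by omega) 2).trans hE2).trans hEb
  have h₃ : N * (n * (3 * n + 9 * N + 20) + 4) ≤ 36 * (E * b) :=
    calc N * (n * (3 * n + 9 * N + 20) + 4) ≤ b * (b * (32 * b) + 4 * b ^ 2) := by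
          refine Nat.mul_le_mul (by omega) (Nat.add_le_add (Nat.mul_le_mul hnb (by omega)) ?_)
          nlinarith
      _ = 36 * b ^ 3 := by ring
      _ ≤ _ := by omega
  have h₄ : n ≤ E * b := hnb.trans (Nat.le_mul_of_pos_left _ hE1)
  have h₅ : 1000 * (ℓ + 1) * (E * b) = 1000 * ((ℓ + 1) * (E * b)) := by ring
  have h₆ : 100 * (ℓ + 1) * (E * b) = 100 * ((ℓ + 1) * (E * b)) := by ring
  have h₇ : E * b ≤ (ℓ + 1) * (E * b) := Nat.le_mul_of_pos_left _ (by omega)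
  rw [h₅]
  rw [h₆] at h₁ h₂
  omega

theorem wp_program (hN : 1 < N) {K ℓ : ℕ} (hℓ : 2 ≤ ℓ) (hn : 1 ≤ n) (hK : N ≤ K * n)
    (M : TreeModel G N) (hleaves : M.host.numRootedLeaves ≤ ℓ) (S : Finset (Fin n))
    (w : Fin n → ℤ) :
    wp program (inputState G S w M) fun τ t =>
      t ≤ 1000 * (ℓ + 1) * (2 * K + 2) ^ (2 * ℓ + 1) * n ^ (2 * ℓ + 1) ∧
      ∃ X, Outputs τ X ∧ IsMinSubsetFVS G S w X := by
  simp only [program, wp_block_cons, wp_block_singleton]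
  refine wp_mono (wp_prepare M S w) fun σ₁ t₁ _ ⟨tips, hnd, hmem, hprep, h9, h10, h12, ht₁⟩ => ?_
  have hr : tips.length ≤ ℓ := by
    refine le_trans (le_of_eq ?_) hleaves
    rw [HostTree.numRootedLeaves, ← List.toFinset_card_of_nodup hnd, ← Set.ncard_coe_finset]
    congr 1
    ext p
    simp [hmem, HostTree.isLeafOf_univ_iff]
  refine wp_mono (wp_mainLoop hprep h9 h10 h12 rfl rfl) fun σ₂ t₂ hF₂ ⟨l, hl, hpw, hall, hlay,
    ht₂⟩ => ?_
  have hprep₂ : Ready M S w σ₂ := hprep.toReady.frame hF₂ (by decide) (by decide)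
  refine wp_mono (wp_writeOutput (by positivity) hprep₂.one hprep₂.zero hprep₂.size
    ((hF₂.1 8 (by decide)).trans hprep.codeCount) hl hall hlay) fun τ t₃ _ ⟨ht₃, hout⟩ => ?_
  have hlen := length_eq_of_nodup hl hall
  refine ⟨le_trans ?_ (time_le hℓ hn hK hr rfl rfl), _, hout,
    isMinSubsetFVS_compl_chosenSet hN (fun p hp => (hmem p).2 hp) w l hl hpw hall⟩
  rw [hlen] at ht₂
  omega

end LeafageSFVS

theorem theorem1 :
    ∃ P : RAMProg, ∀ ℓ : ℕ, 2 ≤ ℓ → ∀ K : ℕ, ∃ C : ℕ,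
      ∀ (n : ℕ) (G : SimpleGraph (Fin n)), G.Connected → leafage G = ℓ →
      ∀ (N : ℕ) (M : TreeModel G N), M.IsExpanded → M.host.numRootedLeaves ≤ ℓ → N ≤ K * n →
      ∀ (S : Finset (Fin n)) (w : Fin n → ℤ),
      ∃ (τ : RAMState) (t : ℕ) (X : Finset (Fin n)),
        Exec P (inputState G S w M) τ t ∧ t ≤ C * n ^ (2 * ℓ + 1) ∧
        Outputs τ X ∧ IsMinSubsetFVS G S w X := by
  refine ⟨LeafageSFVS.program, fun ℓ hℓ K => ⟨1000 * (ℓ + 1) * (2 * K + 2) ^ (2 * ℓ + 1), ?_⟩⟩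
  intro n G hG _ N M hM hleaves hK S w
  obtain ⟨v⟩ := hG.nonempty
  -- In an expanded model a subtree has a leaf different from its root, so the host has at least two
  -- nodes, as required for the existence of tips.
  have hN : 1 < N := by
    obtain ⟨x, hx, hroot, -⟩ := hM.1 v
    obtain ⟨t, ht, -⟩ := (M.isSubtree v).exists_isRootOf
    have hxt : x ≠ t := fun h => hroot (h ▸ ht)
    exact Fin.nontrivial_iff_two_le.1 ⟨x, t, hxt⟩
  obtain ⟨τ, t, hexec, ht, X, hout, hmin⟩ :=
    LeafageSFVS.wp_program hN hℓ (v.pos) hK M hleaves S w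
  exact ⟨τ, t, X, hexec, ht, hout, hmin⟩
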